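/- Let $G$ be a locally compact group with left Haar measure, let $1<p<\infty$, and let $L^p(G)$ be the corresponding space of complex-valued functions. For $t\in G$ and $f\in L^p(G)$ put $(\delta_t*f)(s)=f(t^{-1}s)$, and let $$CV_p(G)=\{T\in B(L^p(G)) : T(\delta_t*f)=\delta_t*T(f)\ \text{ for all } t\in G,\ f\in L^p(G)\}$$ be the algebra of convolution operators on $L^p(G)$. For a Banach space $X$, a linear subspace $\mathcal S\subseteq B(X)$ and $T\in B(X)$ put $$\operatorname{dist}(T,\mathcal S)=\inf_{S\in\mathcal S}\|T-S\|,\qquad \operatorname{dist}_r(T,\mathcal S)=\sup_{\|x\|\le 1}\ \inf_{S\in\mathcal S}\|Tx-Sx\|.$$ The space $\mathcal S$ is called reflexive if it contains every $T\in B(X)$ such that $Tx\in\overline{\{Sx : S\in\mathcal S\}}$ for all $x\in X$. It is called hyperreflexive if there is a constant $C\ge 0$ with $\operatorname{dist}(T,\mathcal S)\le C\operatorname{dist}_r(T,\mathcal S)$ for all $T\in B(X)$; the infimum of all such $C$ is its hyperreflexivity constant. Then $CV_p(G)\subseteq B(L^p(G))$ is reflexive. If, in addition, $G$ is amenable (that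 is, there is a left invariant mean on the space of bounded continuous functions on $G$), then $CV_p(G)$ is hyperreflexive and its hyperreflexivity constant is at most $288\pi(1+\sqrt2)$. -/

import Mathlib

open MeasureTheory BoundedContinuousFunction
open scoped ENNReal

noncomputable section

/-- A topological group is amenable if there is a left invariant mean on the space of bounded
continuous complex functions on it, i.e. a linear functional `m` with `‖m‖ = m 1 = 1` and
`m (s ↦ f (t * s)) = m f`. -/
def IsAmenableGroup (G : Type*) [Group G] [TopologicalSpace G] [IsTopologicalGroup G] : Prop :=
  ∃ m : (G →ᵇ ℂ) →L[ℂ] ℂ, ‖m‖ = 1 ∧ m 1 = 1 ∧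
    ∀ (t : G) (f : G →ᵇ ℂ), m (f.compContinuous (ContinuousMap.mulLeft t)) = m f

section Reflexivity

variable {X : Type*} [NormedAddCommGroup X] [NormedSpace ℂ X]

/-- The orbit `{S x | S ∈ 𝒮}` of a vector under a space of operators. -/
def opOrbit (𝒮 : Submodule ℂ (X →L[ℂ] X)) (x : X) : Set X :=
  (fun S : X →L[ℂ] X => S x) '' (𝒮 : Set (X →L[ℂ] X))

/-- A space of operators is reflexive if it contains every bounded operator `T` such that
`T x` lies in the norm closure of `{S x | S ∈ 𝒮}` for every vector `x`. -/
def IsReflexiveOpSpace (𝒮 : Submodule ℂ (X →L[ℂ] X)) : Prop :=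
  ∀ T : X →L[ℂ] X, (∀ x : X, T x ∈ closure (opOrbit 𝒮 x)) → T ∈ 𝒮

/-- `dist_r(T, 𝒮) = sup_{‖x‖ ≤ 1} inf_{S ∈ 𝒮} ‖T x - S x‖`; the supremum is over a nonempty set
bounded by `‖T‖`. -/
def reflexiveDist (𝒮 : Submodule ℂ (X →L[ℂ] X)) (T : X →L[ℂ] X) : ℝ :=
  ⨆ x : Metric.closedBall (0 : X) 1, Metric.infDist (T x) (opOrbit 𝒮 x)

/-- The constants `C ≥ 0` with `dist(T, 𝒮) ≤ C * dist_r(T, 𝒮)` for all bounded operators `T`. -/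
def hyperreflexivityBounds (𝒮 : Submodule ℂ (X →L[ℂ] X)) : Set ℝ :=
  {C | 0 ≤ C ∧ ∀ T : X →L[ℂ] X,
    Metric.infDist T (𝒮 : Set (X →L[ℂ] X)) ≤ C * reflexiveDist 𝒮 T}

/-- A space of operators is hyperreflexive if its distance is controlled by `dist_r`. -/
def IsHyperreflexive (𝒮 : Submodule ℂ (X →L[ℂ] X)) : Prop :=
  (hyperreflexivityBounds 𝒮).Nonempty

/-- The hyperreflexivity constant of a hyperreflexive space of operators. -/
def hyperreflexivityConst (𝒮 : Submodule ℂ (X →L[ℂ] X)) : ℝ :=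
  sInf (hyperreflexivityBounds 𝒮)

end Reflexivity

section Convolution

variable {G : Type*} [Group G] [TopologicalSpace G] [IsTopologicalGroup G]
  [MeasurableSpace G] [BorelSpace G]

/-- Left translation `f ↦ δ_t * f` on `L^p(G)`, where `(δ_t * f)(s) = f (t⁻¹ * s)`. -/
def leftTranslation (μ : Measure G) [μ.IsMulLeftInvariant] (p : ℝ≥0∞) [Fact (1 ≤ p)] (t : G) :
    Lp ℂ p μ →L[ℂ] Lp ℂ p μ :=
  (Lp.compMeasurePreservingₗᵢ ℂ (fun s : G => t⁻¹ * s)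
    (measurePreserving_mul_left μ t⁻¹)).toContinuousLinearMap

/-- The algebra `CV_p(G)` of bounded operators on `L^p(G)` commuting with all left
translations. -/
def convolutionOperators (μ : Measure G) [μ.IsMulLeftInvariant] (p : ℝ≥0∞) [Fact (1 ≤ p)] :
    Subalgebra ℂ (Lp ℂ p μ →L[ℂ] Lp ℂ p μ) where
  carrier := {T | ∀ (t : G) (f : Lp ℂ p μ),
    T (leftTranslation μ p t f) = leftTranslation μ p t (T f)}
  mul_mem' := by
    intro S T hS hT t f
    simp only [mul_apply_eq_comp, hT t f, hS t (T f)]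
  add_mem' := by
    intro S T hS hT t f
    simp only [_root_.add_apply, hS t f, hT t f, map_add]
  algebraMap_mem' := by
    intro c t f
    simp only [Algebra.algebraMap_eq_smul_one, _root_.smul_apply,
      one_apply_eq_self, map_smul]

end Convolution

end

/-! Let `ρ` be the left regular representation, `ε` the pointwise distance of `T` from the
commutant, and `κ` the supremum over `t` of `‖ρ t * T * ρ t⁻¹ - T‖`. The core is an estimate `κ ≤ K
ε` with an absolute constant `K`.

If `E * F = 0` and `F` commutes with the commutant, then `E * S * F = 0` for every `S` in it, so `‖E
* T * F‖ ≤ ε` for contractions `E`, `F` (`norm_mul_mul_le_of_commute`). Such pairs come from a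
single `t`: absolutely convergent Fourier series evaluated at the powers of `ρ t`, applied to tents
of half width `1/N` on the circle with disjoint supports. The finite Fourier transform of the tent
operators `e j` gives contractions `a r` with `a 0 = 1` and `a (±1)` within `O(1/N²)` of `(ρ
t)^(±1)`. The commutator of `T` with `a 1`, times `a (-1)`, is a combination of sums `G d` over
pairs of tents at offset `d`. Distant offsets cost a multiple of `ε`. Since the `G d` sum to zero,
the coefficients of the near ones may be lowered by 1, which makes them `O(1/N)`. Hence `κ ≤ c ε +
O(1/N) κ`, and `N = 20` lets the last term be absorbed.

With `ε = 0` this is reflexivity. For amenable `G`, averaging `ρ t * T * ρ t⁻¹` against an invariant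
mean gives an element of the commutant within `κ` of `T`. The average exists as an operator because
`L^p` is a reflexive Banach space, by uniform convexity and Milman–Pettis. -/

noncomputable section

/-! ### Fourier series of a tent, via the second Bernoulli polynomial -/

section FejerWeight

/-- The weights `sinc(π n / N) ^ 2`: up to the factor `N`, the Fourier coefficients of the tent
function of half width `1 / N` on the circle. -/
def fejerWeight (N : ℕ) (n : ℤ) : ℝ := Real.sinc (Real.pi * n / N) ^ 2

lemma fejerWeight_nonneg (N : ℕ) (n : ℤ) : 0 ≤ fejerWeight N n := sq_nonneg _

@[simp] lemma fejerWeight_zero (N : ℕ) : fejerWeight N 0 = 1 := by simp [fejerWeight]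

/-- As `4 sin²(πn/N) = 2 - e(n/N) - e(-n/N)`, the weights turn the series of `n⁻² e(nx)` into its
second difference with step `1/N`; that series is a multiple of `B₂`. The term `n = 0`, where `1/n²
= 0` by convention, is added separately. -/
lemma fejerWeight_mul_fourier (N : ℕ) [NeZero N] (n : ℤ) (x : UnitAddCircle) :
    (fejerWeight N n : ℂ) * fourier n x =
      (if n = 0 then 1 else 0) + (N : ℂ) ^ 2 / (2 * Real.pi ^ 2) *
        (1 / (n : ℂ) ^ 2 * fourier n x -
          (1 / (n : ℂ) ^ 2 * fourier n (x + ((1 / N : ℝ) : UnitAddCircle)) +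
            1 / (n : ℂ) ^ 2 * fourier n (x - ((1 / N : ℝ) : UnitAddCircle))) / 2) := by
  by_cases hn : n = 0
  · subst hn
    simp
  have hN : (N : ℂ) ≠ 0 := Nat.cast_ne_zero.mpr (NeZero.ne N)
  have hn' : (n : ℂ) ≠ 0 := Int.cast_ne_zero.mpr hn
  have hpi : (Real.pi : ℂ) ≠ 0 := Complex.ofReal_ne_zero.mpr Real.pi_ne_zero
  have hadd : ∀ y z : UnitAddCircle, fourier n (y + z) = fourier n y * fourier n z := by
    intro y z
    simp only [fourier_apply, smul_add, AddCircle.toCircle_add, Circle.coe_mul]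
  have h1 : fourier n (((1 / N : ℝ) : UnitAddCircle)) +
      fourier n (-((1 / N : ℝ) : UnitAddCircle)) = 2 - 4 * Complex.sin (Real.pi * n / N) ^ 2 := by
    rw [← AddCircle.coe_neg, fourier_coe_apply, fourier_coe_apply]
    have h2 : Complex.sin (Real.pi * n / N) ^ 2 =
        1 / 2 - Complex.cos (2 * (Real.pi * n / N)) / 2 := by
      rw [Complex.cos_two_mul, Complex.cos_sq']; ring
    rw [h2, Complex.cos]
    have e1 : (2 * Real.pi * Complex.I * n * ((1 / N : ℝ) : ℂ) / ((1 : ℝ) : ℂ)) =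
        2 * (Real.pi * n / N) * Complex.I := by push_cast; field_simp
    have e2 : (2 * Real.pi * Complex.I * n * ((-(1 / N) : ℝ) : ℂ) / ((1 : ℝ) : ℂ)) =
        -(2 * (Real.pi * n / N)) * Complex.I := by push_cast; field_simp
    rw [e1, e2]; ring
  rw [sub_eq_add_neg x, hadd, hadd]
  have h3 : (fejerWeight N n : ℂ) = Complex.sin (Real.pi * n / N) ^ 2 / (Real.pi * n / N) ^ 2 := by
    rw [fejerWeight, Real.sinc_of_ne_zero]
    · push_cast; rw [div_pow]
    · have : (N : ℝ) ≠ 0 := Nat.cast_ne_zero.mpr (NeZero.ne N)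
      have : (n : ℝ) ≠ 0 := Int.cast_ne_zero.mpr hn
      positivity
  have h4 : fourier n x * fourier n (((1 / N : ℝ) : UnitAddCircle)) +
      fourier n x * fourier n (-((1 / N : ℝ) : UnitAddCircle)) =
      fourier n x * (2 - 4 * Complex.sin (Real.pi * n / N) ^ 2) := by rw [← h1]; ring
  rw [← mul_add, h4, h3, if_neg hn]
  field_simp
  ring

lemma hasSum_fejerWeight_mul_fourier (N : ℕ) [NeZero N] {x y z : ℝ} (hx : x ∈ Set.Icc (0 : ℝ) 1)
    (hy : y ∈ Set.Icc (0 : ℝ) 1) (hz : z ∈ Set.Icc (0 : ℝ) 1)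
    (hxy : (y : UnitAddCircle) = x + ((1 / N : ℝ) : UnitAddCircle))
    (hxz : (z : UnitAddCircle) = x - ((1 / N : ℝ) : UnitAddCircle)) :
    HasSum (fun n : ℤ => (fejerWeight N n : ℂ) * fourier n (x : UnitAddCircle))
      (1 + N ^ 2 * (bernoulliFun 2 x - (bernoulliFun 2 y + bernoulliFun 2 z) / 2)) := by
  simp_rw [fejerWeight_mul_fourier, ← hxy, ← hxz]
  have key := ((hasSum_one_div_pow_mul_fourier_mul_bernoulliFun le_rfl hx).sub
    (((hasSum_one_div_pow_mul_fourier_mul_bernoulliFun le_rfl hy).add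
    (hasSum_one_div_pow_mul_fourier_mul_bernoulliFun le_rfl hz)).div_const 2)).mul_left
    ((N : ℂ) ^ 2 / (2 * Real.pi ^ 2))
  convert (hasSum_ite_eq (0 : ℤ) (1 : ℂ)).add key using 1
  have hpi : (Real.pi : ℂ) ≠ 0 := Complex.ofReal_ne_zero.mpr Real.pi_ne_zero
  have : (2 * (Real.pi : ℂ) * Complex.I) ^ 2 = - (4 * Real.pi ^ 2) := by
    rw [mul_pow, Complex.I_sq]; ring
  rw [this]
  simp only [Nat.factorial_two]
  field_simp
  push_cast
  ring

/-- Here `x ± 1/N` do not leave `[0, 1]`, so the second difference of the quadratic `B₂` is constant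
and cancels the term 1. -/
lemma hasSum_fejerWeight_mul_fourier_eq_zero (N : ℕ) [NeZero N] {x : ℝ}
    (hx : x ∈ Set.Icc (1 / N : ℝ) (1 - 1 / N)) :
    HasSum (fun n : ℤ => (fejerWeight N n : ℂ) * fourier n (x : UnitAddCircle)) 0 := by
  have hN : (0 : ℝ) < 1 / N := by have := NeZero.pos N; positivity
  have hN' : (N : ℂ) ≠ 0 := Nat.cast_ne_zero.mpr (NeZero.ne N)
  obtain ⟨h1, h2⟩ := hx
  convert hasSum_fejerWeight_mul_fourier N (x := x) (y := x + 1 / N) (z := x - 1 / N)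
    ⟨by linarith, by linarith⟩ ⟨by linarith, by linarith⟩ ⟨by linarith, by linarith⟩
    (AddCircle.coe_add _ _ _) (AddCircle.coe_sub _ _ _) using 1
  simp only [bernoulliFun_two]
  push_cast
  field_simp
  ring

lemma hasSum_fejerWeight (N : ℕ) [NeZero N] :
    HasSum (fun n : ℤ => (fejerWeight N n : ℂ)) N := by
  have hN1 : (1 : ℝ) ≤ N := by exact_mod_cast NeZero.one_le
  have hN : (0 : ℝ) < 1 / N := by positivity
  have hN2 : 1 / (N : ℝ) ≤ 1 := by rw [div_le_one (by positivity)]; exact hN1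
  have hN' : (N : ℂ) ≠ 0 := Nat.cast_ne_zero.mpr (NeZero.ne N)
  have := hasSum_fejerWeight_mul_fourier N (x := 0) (y := 1 / N) (z := 1 - 1 / N)
    ⟨by linarith, by linarith⟩ ⟨by linarith, by linarith⟩ ⟨by linarith, by linarith⟩
    (by simp) (by rw [AddCircle.coe_sub, AddCircle.coe_period]; simp)
  simp only [AddCircle.coe_zero, fourier_eval_zero, mul_one] at this
  convert this using 1
  simp only [bernoulliFun_two]
  push_cast
  field_simp
  ring

lemma summable_fejerWeight (N : ℕ) [NeZero N] : Summable (fejerWeight N) := by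
  exact_mod_cast (hasSum_fejerWeight N).summable

end FejerWeight

/-! ### Functional calculus for absolutely convergent Fourier series -/

section WienerAlgebra

variable {a b : ℤ → ℂ}

lemma integral_fourier_haarAddCircle (n : ℤ) :
    ∫ x : UnitAddCircle, fourier n x ∂AddCircle.haarAddCircle = if n = 0 then 1 else 0 := by
  have h := congrFun (fourierCoeff_fourier (T := 1) n) 0
  simp only [fourierCoeff, neg_zero, fourier_zero, one_smul] at h
  rw [h, Pi.single_apply]
  simp [eq_comm]

lemma norm_fourier_apply (n : ℤ) (x : UnitAddCircle) : ‖fourier n x‖ = 1 := by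
  rw [fourier_apply]; exact Circle.norm_coe _

lemma continuous_tsum_mul_fourier (ha : Summable fun n => ‖a n‖) :
    Continuous fun x : UnitAddCircle => ∑' n, a n * fourier n x :=
  continuous_tsum (fun n => (map_continuous (fourier n)).const_mul (a n)) ha
    (fun n x => by rw [norm_mul, norm_fourier_apply, mul_one])

lemma integral_tsum_mul_fourier_mul (ha : Summable fun n => ‖a n‖) {g : UnitAddCircle → ℂ}
    (hg : Continuous g) :
    ∫ x, (∑' n, a n * fourier n x) * g x ∂AddCircle.haarAddCircle =
      ∑' n, a n * ∫ x, fourier n x * g x ∂AddCircle.haarAddCircle := by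
  obtain ⟨C, hC⟩ : ∃ C, ∀ x, ‖g x‖ ≤ C := by
    obtain ⟨C, hC⟩ := isCompact_univ.exists_bound_of_continuousOn hg.continuousOn
    exact ⟨C, fun x => hC x (Set.mem_univ x)⟩
  have hcont : ∀ n, Continuous fun x : UnitAddCircle => a n * (fourier n x * g x) := fun n =>
    ((map_continuous (fourier n)).mul hg).const_mul (a n)
  have hb : ∀ n (x : UnitAddCircle), ‖a n * (fourier n x * g x)‖ ≤ ‖a n‖ * C := by
    intro n x
    rw [norm_mul, norm_mul, norm_fourier_apply, one_mul]
    exact mul_le_mul_of_nonneg_left (hC x) (norm_nonneg _)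
  have hInt : ∀ n, Integrable (fun x : UnitAddCircle => a n * (fourier n x * g x))
      AddCircle.haarAddCircle := fun n =>
    (integrable_const (‖a n‖ * C)).mono' (hcont n).aestronglyMeasurable
      (Filter.Eventually.of_forall (hb n))
  have hsum : Summable fun n => ∫ x, ‖a n * (fourier n x * g x)‖ ∂AddCircle.haarAddCircle := by
    refine Summable.of_nonneg_of_le (fun n => integral_nonneg fun x => norm_nonneg _) (fun n => ?_)
      (ha.mul_right C)
    refine (integral_mono (hInt n).norm (integrable_const _) (hb n)).trans ?_
    simp
  have h := integral_tsum_of_summable_integral_norm hInt hsum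
  simp_rw [integral_const_mul] at h
  rw [h]
  refine integral_congr_ae (Filter.Eventually.of_forall fun x => ?_)
  simp only [← mul_assoc]
  rw [tsum_mul_right]

lemma integral_tsum_mul_fourier_mul_fourier (ha : Summable fun n => ‖a n‖) (k : ℤ) :
    ∫ x : UnitAddCircle, (∑' n, a n * fourier n x) * fourier k x ∂AddCircle.haarAddCircle =
      a (-k) := by
  rw [integral_tsum_mul_fourier_mul ha (map_continuous (fourier k))]
  simp_rw [← fourier_add, integral_fourier_haarAddCircle]
  rw [tsum_eq_single (-k)]
  · simp
  · intro n hn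
    rw [if_neg (by omega), mul_zero]

/-- If the product of two absolutely convergent Fourier series vanishes, then so does the
convolution of their coefficients. -/
lemma tsum_mul_sub_eq_zero_of_fourier_mul_eq_zero (ha : Summable fun n => ‖a n‖)
    (hb : Summable fun n => ‖b n‖)
    (h : ∀ x : UnitAddCircle, (∑' n, a n * fourier n x) * ∑' n, b n * fourier n x = 0) (k : ℤ) :
    ∑' m, a m * b (k - m) = 0 := by
  have h1 := integral_tsum_mul_fourier_mul ha
    (g := fun x => (∑' n, b n * fourier n x) * fourier (-k) x)
    ((continuous_tsum_mul_fourier hb).mul (map_continuous (fourier (-k))))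
  have h2 : ∀ x : UnitAddCircle, (∑' n, a n * fourier n x) *
      ((∑' n, b n * fourier n x) * fourier (-k) x) = 0 := fun x => by rw [← mul_assoc, h, zero_mul]
  rw [integral_congr_ae (Filter.Eventually.of_forall h2), integral_zero] at h1
  rw [h1]
  refine tsum_congr fun m => ?_
  congr 1
  rw [show k - m = -(m + -k) by ring, ← integral_tsum_mul_fourier_mul_fourier hb]
  refine integral_congr_ae (Filter.Eventually.of_forall fun x => ?_)
  simp only [fourier_add]
  ring

variable {A : Type*} [NormedRing A] [NormedAlgebra ℂ A] {u : ℤ → A}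

lemma summable_norm_smul (hu : ∀ n, ‖u n‖ ≤ 1) (ha : Summable fun n => ‖a n‖) :
    Summable fun n => ‖a n • u n‖ :=
  Summable.of_nonneg_of_le (fun _ => norm_nonneg _)
    (fun n => (norm_smul_le _ _).trans (mul_le_of_le_one_right (norm_nonneg _) (hu n))) ha

/-- Evaluation of an absolutely convergent Fourier series at a bounded sequence. -/
def wienerEval (u : ℤ → A) (a : ℤ → ℂ) : A := ∑' n, a n • u n

lemma norm_wienerEval_le (hu : ∀ n, ‖u n‖ ≤ 1) (ha : Summable fun n => ‖a n‖) :
    ‖wienerEval u a‖ ≤ ∑' n, ‖a n‖ :=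
  tsum_of_norm_bounded ha.hasSum fun n =>
    (norm_smul_le _ _).trans (mul_le_of_le_one_right (norm_nonneg _) (hu n))

lemma wienerEval_single (k : ℤ) : wienerEval u (fun n => if n = k then 1 else 0) = u k := by
  rw [wienerEval, tsum_eq_single k fun n hn => by simp [hn]]
  simp

variable [CompleteSpace A]

lemma norm_wienerEval_commutator_le {κ : ℝ} {T : A} (hu : ∀ n, ‖u n‖ ≤ 1)
    (hT : ∀ n, ‖u n * T - T * u n‖ ≤ κ) (ha : Summable fun n => ‖a n‖) :
    ‖wienerEval u a * T - T * wienerEval u a‖ ≤ (∑' n, ‖a n‖) * κ := by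
  have hs := (summable_norm_smul hu ha).of_norm
  have h := (hs.hasSum.mul_right T).sub (hs.hasSum.mul_left T)
  rw [wienerEval, ← h.tsum_eq]
  refine tsum_of_norm_bounded (ha.hasSum.mul_right κ) fun n => ?_
  rw [smul_mul_assoc, mul_smul_comm, ← smul_sub]
  exact (norm_smul_le _ _).trans (mul_le_mul_of_nonneg_left (hT n) (norm_nonneg _))

lemma Commute.wienerEval_right {S : A} (hu : ∀ n, ‖u n‖ ≤ 1) (hS : ∀ n, Commute S (u n))
    (ha : Summable fun n => ‖a n‖) : Commute S (wienerEval u a) := by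
  have hs := (summable_norm_smul hu ha).of_norm
  change S * wienerEval u a = wienerEval u a * S
  rw [wienerEval, ← hs.tsum_mul_left, ← hs.tsum_mul_right]
  exact tsum_congr fun n => ((hS n).smul_right (a n)).eq

lemma wienerEval_sub (hu : ∀ n, ‖u n‖ ≤ 1) (ha : Summable fun n => ‖a n‖)
    (hb : Summable fun n => ‖b n‖) :
    wienerEval u (fun n => a n - b n) = wienerEval u a - wienerEval u b := by
  simp only [wienerEval, sub_smul]
  exact (summable_norm_smul hu ha).of_norm.tsum_sub (summable_norm_smul hu hb).of_norm

lemma wienerEval_sum_mul {ι : Type*} (s : Finset ι) (c : ι → ℂ) {f : ι → ℤ → ℂ}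
    (hu : ∀ n, ‖u n‖ ≤ 1) (hf : ∀ i, Summable fun n => ‖f i n‖) :
    wienerEval u (fun n => ∑ i ∈ s, c i * f i n) = ∑ i ∈ s, c i • wienerEval u (f i) := by
  simp only [wienerEval, Finset.sum_smul, mul_smul]
  rw [Summable.tsum_finsetSum fun i _ => ((summable_norm_smul hu (hf i)).of_norm.const_smul (c i))]
  exact Finset.sum_congr rfl fun i _ => (summable_norm_smul hu (hf i)).of_norm.tsum_const_smul (c i)

/-- Absolutely convergent Fourier series with vanishing product have vanishing product when
evaluated at a bounded representation of `ℤ`. -/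
lemma wienerEval_mul_eq_zero (hu : ∀ n, ‖u n‖ ≤ 1) (hadd : ∀ m n, u (m + n) = u m * u n)
    (ha : Summable fun n => ‖a n‖) (hb : Summable fun n => ‖b n‖)
    (h : ∀ x : UnitAddCircle, (∑' n, a n * fourier n x) * ∑' n, b n * fourier n x = 0) :
    wienerEval u a * wienerEval u b = 0 := by
  have hsa := summable_norm_smul hu ha
  have hsb := summable_norm_smul hu hb
  have hs := summable_mul_of_summable_norm hsa hsb
  rw [wienerEval, wienerEval, tsum_mul_tsum_of_summable_norm hsa hsb]
  -- Reindexing by `k = m + n`: the inner sum becomes the `k`-th convolution coefficient times `u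
  -- k`.
  let e : ℤ × ℤ ≃ ℤ × ℤ :=
    { toFun := fun q => (q.2, q.1 - q.2)
      invFun := fun q => (q.1 + q.2, q.1)
      left_inv := fun q => by simp
      right_inv := fun q => by simp }
  have he : Summable fun q => (a (e q).1 • u (e q).1) * (b (e q).2 • u (e q).2) :=
    e.summable_iff.mpr hs
  rw [← e.tsum_eq, he.tsum_prod]
  have hterm : ∀ k m : ℤ, (a (e (k, m)).1 • u (e (k, m)).1) * (b (e (k, m)).2 • u (e (k, m)).2) =
      (a m * b (k - m)) • u k := by
    intro k m
    change (a m • u m) * (b (k - m) • u (k - m)) = _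
    rw [smul_mul_smul_comm, ← hadd, add_sub_cancel]
  simp_rw [hterm]
  have hz : ∀ k, ∑' m, (a m * b (k - m)) • u k = 0 := by
    intro k
    have hab : Summable fun m => a m * b (k - m) := by
      refine Summable.of_norm ?_
      have hbd : ∃ C, ∀ n, ‖b n‖ ≤ C :=
        ⟨∑' n, ‖b n‖, fun n => hb.le_tsum n fun _ _ => norm_nonneg _⟩
      obtain ⟨C, hC⟩ := hbd
      refine Summable.of_nonneg_of_le (fun _ => norm_nonneg _) (fun m => ?_) (ha.mul_right C)
      rw [norm_mul]
      exact mul_le_mul_of_nonneg_left (hC _) (norm_nonneg _)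
    rw [hab.tsum_smul_const, tsum_mul_sub_eq_zero_of_fourier_mul_eq_zero ha hb h, zero_smul]
  simp_rw [hz, tsum_zero]

end WienerAlgebra

/-! ### Weights on residue classes and tents centred at `j / N` -/

section ResidueWeight

variable (N : ℕ)

/-- The restriction of the weights `fejerWeight N` to a residue class. -/
def residueWeight (r : ZMod N) (n : ℤ) : ℂ := if (n : ZMod N) = r then (fejerWeight N n : ℂ) else 0

lemma norm_residueWeight (r : ZMod N) (n : ℤ) :
    (‖residueWeight N r n‖ : ℂ) = residueWeight N r n := by
  unfold residueWeight
  split_ifs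
  · rw [Complex.norm_real, Real.norm_of_nonneg (fejerWeight_nonneg N n)]
  · simp

variable [NeZero N]

lemma stdAddChar_mul_intCast (j : ZMod N) (n : ℤ) :
    ZMod.stdAddChar (j * (n : ZMod N)) = fourier n (ZMod.toAddCircle j) := by
  rw [fourier_apply, ← map_zsmul, zsmul_eq_mul, mul_comm j]
  rfl

lemma norm_stdAddChar (j : ZMod N) : ‖ZMod.stdAddChar j‖ = 1 := Circle.norm_coe _

lemma sum_stdAddChar_mul (b : ZMod N) :
    ∑ x : ZMod N, ZMod.stdAddChar (x * b) = if b = 0 then (N : ℂ) else 0 := by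
  have h := AddChar.sum_mulShift b (ZMod.isPrimitive_stdAddChar N)
  rw [h, ZMod.card]
  simp

lemma hasSum_fejerWeight_mul_stdAddChar (j : ZMod N) :
    HasSum (fun n : ℤ => (fejerWeight N n : ℂ) * ZMod.stdAddChar (j * (n : ZMod N)))
      (if j = 0 then N else 0) := by
  split_ifs with hj
  · subst hj
    simpa using hasSum_fejerWeight N
  · simp_rw [stdAddChar_mul_intCast, ZMod.toAddCircle_apply]
    apply hasSum_fejerWeight_mul_fourier_eq_zero
    have hN : (0 : ℝ) < N := by exact_mod_cast NeZero.pos N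
    have h1 : 1 ≤ j.val := Nat.one_le_iff_ne_zero.mpr ((ZMod.val_ne_zero j).mpr hj)
    have h2 : j.val + 1 ≤ N := ZMod.val_lt j
    have h1' : (1 : ℝ) ≤ j.val := by exact_mod_cast h1
    have h2' : (j.val : ℝ) + 1 ≤ N := by exact_mod_cast h2
    constructor
    · gcongr
    · rw [le_sub_iff_add_le, ← add_div, div_le_one hN]
      exact h2'

/-- Characters of `ZMod N` select the residue class; only `j = 0` survives, because the tent
vanishes at the nonzero multiples of `1/N`. -/
lemma hasSum_residueWeight (r : ZMod N) : HasSum (residueWeight N r) 1 := by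
  have hN : (N : ℂ) ≠ 0 := Nat.cast_ne_zero.mpr (NeZero.ne N)
  have h := (hasSum_sum (s := Finset.univ) fun j _ =>
    ((hasSum_fejerWeight_mul_stdAddChar N j).mul_left
      (ZMod.stdAddChar (-(j * r))))).mul_left (1 / N : ℂ)
  have hsum : (1 / N : ℂ) * ∑ j : ZMod N, ZMod.stdAddChar (-(j * r)) * (if j = 0 then (N : ℂ) else 0)
      = 1 := by simp [hN]
  rw [hsum] at h
  refine Eq.mpr (congrArg (fun f : ℤ → ℂ => HasSum f 1) (funext fun n => ?_)) h
  have : ∀ j : ZMod N, ZMod.stdAddChar (-(j * r)) *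
      ((fejerWeight N n : ℂ) * ZMod.stdAddChar (j * (n : ZMod N))) =
      (fejerWeight N n : ℂ) * ZMod.stdAddChar (j * ((n : ZMod N) - r)) := by
    intro j
    rw [mul_left_comm, ← AddChar.map_add_eq_mul]
    congr 2
    ring
  simp_rw [this]
  rw [← Finset.mul_sum, sum_stdAddChar_mul, residueWeight]
  simp only [sub_eq_zero]
  split_ifs
  · field_simp
  · simp

lemma hasSum_norm_residueWeight (r : ZMod N) : HasSum (fun n => ‖residueWeight N r n‖) 1 := by
  have h := hasSum_residueWeight N r
  rw [← (funext (norm_residueWeight N r) : (fun n => (‖residueWeight N r n‖ : ℂ)) = _),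
    ← Complex.ofReal_one] at h
  exact Complex.hasSum_ofReal.mp h

/-- The norms of the weights have total 1, already attained at `n = 0`. -/
lemma residueWeight_zero : residueWeight N 0 = fun n => if n = 0 then 1 else 0 := by
  have h := hasSum_norm_residueWeight N 0
  have h0 : ‖residueWeight N 0 0‖ = 1 := by simp [residueWeight]
  funext n
  split_ifs with hn
  · subst hn
    simp [residueWeight]
  · have := h.summable.sum_le_tsum {0, n} fun _ _ => norm_nonneg _
    rw [h.tsum_eq, Finset.sum_pair (Ne.symm hn), h0] at this
    exact norm_le_zero_iff.mp (by linarith)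

/-- The `ℓ¹` distance of the weights on the residue class of `k` from the unit mass at `k`. -/
lemma hasSum_norm_residueWeight_sub (k : ℤ) :
    HasSum (fun n => ‖residueWeight N k n - if n = k then 1 else 0‖) (2 * (1 - fejerWeight N k)) := by
  -- Only the term at `k` changes, from `w` to `1 - w`, whence the correction `1 - 2w`.
  have h := (hasSum_norm_residueWeight N k).add
    (hasSum_ite_eq k (1 - 2 * fejerWeight N k))
  convert h using 1
  · ext n
    by_cases hn : n = k
    · subst hn
      have h1 : fejerWeight N n ≤ 1 := by
        rw [fejerWeight, sq_le_one_iff_abs_le_one]; exact Real.abs_sinc_le_one _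
      have h0 := fejerWeight_nonneg N n
      simp only [residueWeight, if_true]
      rw [← Complex.ofReal_one, ← Complex.ofReal_sub, Complex.norm_real, Complex.norm_real,
        Real.norm_of_nonneg h0, Real.norm_of_nonpos (by linarith)]
      ring
    · simp [hn]
  · ring

/-- The Fourier coefficients of the tent function of half width `1 / N` centred at `j / N`. -/
def tentCoeff (j : ZMod N) (n : ℤ) : ℂ :=
  ∑ r : ZMod N, (ZMod.stdAddChar (-(j * r)) / N) * residueWeight N r n

lemma tentCoeff_eq (j : ZMod N) (n : ℤ) :
    tentCoeff N j n = ZMod.stdAddChar (-(j * (n : ZMod N))) / N * fejerWeight N n := by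
  rw [tentCoeff, Finset.sum_eq_single (n : ZMod N)]
  · simp [residueWeight]
  · intro r _ hr
    simp [residueWeight, hr.symm]
  · simp

lemma summable_norm_tentCoeff (j : ZMod N) : Summable fun n => ‖tentCoeff N j n‖ := by
  refine (((summable_fejerWeight N).mul_left (1 / N : ℝ))).congr fun n => ?_
  rw [tentCoeff_eq, norm_mul, norm_div, norm_stdAddChar, Complex.norm_real,
    Real.norm_of_nonneg (fejerWeight_nonneg N n)]
  simp

lemma tentCoeff_mul_fourier (j : ZMod N) (n : ℤ) (x : UnitAddCircle) :
    tentCoeff N j n * fourier n x =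
      (1 / N : ℂ) * ((fejerWeight N n : ℂ) * fourier n (x - ZMod.toAddCircle j)) := by
  have : fourier n (x - ZMod.toAddCircle j) =
      fourier n x * ZMod.stdAddChar (-(j * (n : ZMod N))) := by
    rw [← neg_mul, stdAddChar_mul_intCast, map_neg, sub_eq_add_neg]
    simp only [fourier_apply, smul_add, AddCircle.toCircle_add, Circle.coe_mul]
  rw [tentCoeff_eq, this]
  ring

lemma tsum_tentCoeff_mul_eq_zero {j k : ZMod N} (h0 : j - k ≠ 0) (h1 : j - k ≠ 1)
    (h2 : j - k ≠ -1) (x : UnitAddCircle) :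
    (∑' n, tentCoeff N j n * fourier n x) * ∑' n, tentCoeff N k n * fourier n x = 0 := by
  have hN : (0 : ℝ) < N := by exact_mod_cast NeZero.pos N
  have hN' : (N : ℝ) ≠ 0 := hN.ne'
  simp_rw [tentCoeff_mul_fourier, tsum_mul_left]
  obtain ⟨s, hs, hsx⟩ : ∃ s : ℝ, s ∈ Set.Ico (0 : ℝ) 1 ∧
      (s : UnitAddCircle) = x - ZMod.toAddCircle j := by
    have : x - ZMod.toAddCircle j ∈ ((↑) : ℝ → UnitAddCircle) '' Set.Ico 0 (0 + 1) := by
      rw [AddCircle.coe_image_Ico_eq]; trivial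
    obtain ⟨s, hs, h⟩ := this
    exact ⟨s, by simpa using hs, h⟩
  have hk : x - ZMod.toAddCircle k = (s : UnitAddCircle) + ZMod.toAddCircle (j - k) := by
    rw [hsx, map_sub]; abel
  have hd : (2 : ℝ) ≤ (j - k).val ∧ ((j - k).val : ℝ) + 2 ≤ N := by
    set d := j - k with hdef
    have e0 : d.val ≠ 0 := (ZMod.val_ne_zero d).mpr h0
    have e1 : d.val ≠ 1 := fun h => h1 (by
      rw [← ZMod.natCast_zmod_val d, h, Nat.cast_one])
    have e2 : d.val ≠ N - 1 := fun h => h2 (by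
      rw [← ZMod.natCast_zmod_val d, h, Nat.cast_sub NeZero.one_le]; simp)
    have e3 := ZMod.val_lt d
    constructor
    · exact_mod_cast (show 2 ≤ d.val by omega)
    · exact_mod_cast (show d.val + 2 ≤ N by omega)
  obtain ⟨hd1, hd2⟩ := hd
  have hd1' : 2 / (N : ℝ) ≤ (j - k).val / N := by gcongr
  have hd2' : ((j - k).val : ℝ) / N + 2 / N ≤ 1 := by
    rw [← add_div, div_le_one hN]; exact hd2
  have e2 : 2 / (N : ℝ) = 1 / N + 1 / N := by ring
  rw [ZMod.toAddCircle_apply (j - k)] at hk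
  -- `s` is the position relative to the centre `j / N`. Within `1/N` of it, on either side, the
  -- tent at `k` vanishes, since the offset is at least `2/N` both ways; elsewhere the tent at `j`
  -- does.
  rcases lt_or_ge s (1 / N) with hs1 | hs1
  · rw [hk, ← AddCircle.coe_add, (hasSum_fejerWeight_mul_fourier_eq_zero N
      ⟨by linarith [hs.1], by linarith⟩).tsum_eq]
    simp
  rcases le_or_gt s (1 - 1 / N) with hs2 | hs2
  · rw [← hsx, (hasSum_fejerWeight_mul_fourier_eq_zero N ⟨hs1, hs2⟩).tsum_eq]
    simp
  · have : (s : UnitAddCircle) + (((j - k).val / N : ℝ) : UnitAddCircle) =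
        ((s - 1 + (j - k).val / N : ℝ) : UnitAddCircle) := by
      rw [AddCircle.coe_add, AddCircle.coe_sub, AddCircle.coe_period, sub_zero]
    rw [hk, this, (hasSum_fejerWeight_mul_fourier_eq_zero N
      ⟨by linarith [hs.1], by linarith [hs.2]⟩).tsum_eq]
    simp

end ResidueWeight

/-! ### Bilinear maps and the finite Fourier transform -/

section FiniteFourier

variable {N : ℕ} [NeZero N] {V W : Type*} [AddCommGroup V] [Module ℂ V] [AddCommGroup W]
  [Module ℂ W]

lemma eq_sum_stdAddChar_smul_of_eq {a e : ZMod N → V}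
    (he : ∀ j, e j = ∑ r, (ZMod.stdAddChar (-(j * r)) / N : ℂ) • a r) (r : ZMod N) :
    a r = ∑ j, ZMod.stdAddChar (j * r) • e j := by
  have hN : (N : ℂ) ≠ 0 := Nat.cast_ne_zero.mpr (NeZero.ne N)
  simp_rw [he, Finset.smul_sum, smul_smul]
  rw [Finset.sum_comm]
  have h : ∀ s : ZMod N, ∑ j : ZMod N,
      (ZMod.stdAddChar (j * r) * (ZMod.stdAddChar (-(j * s)) / N : ℂ)) • a s =
      if s = r then a s else 0 := by
    intro s
    rw [← Finset.sum_smul]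
    have h1 : ∀ j : ZMod N, ZMod.stdAddChar (j * r) * (ZMod.stdAddChar (-(j * s)) / N : ℂ) =
        ZMod.stdAddChar (j * (r - s)) / N := by
      intro j
      rw [← mul_div_assoc, ← AddChar.map_add_eq_mul]
      congr 2
      ring
    simp_rw [h1, ← Finset.sum_div, sum_stdAddChar_mul, sub_eq_zero, eq_comm (a := r)]
    split_ifs
    · rw [div_self hN, one_smul]
    · simp
  simp_rw [h]
  simp

/-- Expanding only the first argument leaves a character of `k`; summing over `k` then inverts the
transform in the second argument. -/
lemma sum_bilin_shift_eq {a e : ZMod N → V}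
    (he : ∀ j, e j = ∑ r, (ZMod.stdAddChar (-(j * r)) / N : ℂ) • a r)
    (β : V →ₗ[ℂ] V →ₗ[ℂ] W) (d : ZMod N) :
    ∑ k, β (e (k + d)) (e k) =
      ∑ r, (ZMod.stdAddChar (-(d * r)) / N : ℂ) • β (a r) (a (-r)) := by
  have hN : (N : ℂ) ≠ 0 := Nat.cast_ne_zero.mpr (NeZero.ne N)
  have h1 : ∀ k, β (e (k + d)) (e k) = ∑ r, (ZMod.stdAddChar (-(d * r)) / N : ℂ) •
      (ZMod.stdAddChar (k * (-r)) • β (a r) (e k)) := by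
    intro k
    rw [he (k + d), map_sum, LinearMap.sum_apply]
    refine Finset.sum_congr rfl fun r _ => ?_
    rw [map_smul, LinearMap.smul_apply, smul_smul]
    congr 1
    rw [div_mul_eq_mul_div, ← AddChar.map_add_eq_mul]
    congr 2
    ring
  simp_rw [h1]
  rw [Finset.sum_comm]
  refine Finset.sum_congr rfl fun r _ => ?_
  rw [← Finset.smul_sum, eq_sum_stdAddChar_smul_of_eq he (-r), map_sum]
  simp_rw [map_smul]

lemma bilin_eq_sum_shift {a e : ZMod N → V}
    (he : ∀ j, e j = ∑ r, (ZMod.stdAddChar (-(j * r)) / N : ℂ) • a r)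
    (β : V →ₗ[ℂ] V →ₗ[ℂ] W) (r : ZMod N) :
    β (a r) (a (-r)) = ∑ d, ZMod.stdAddChar (d * r) • ∑ k, β (e (k + d)) (e k) := by
  rw [eq_sum_stdAddChar_smul_of_eq
    (a := fun r => β (a r) (a (-r))) (e := fun d => ∑ k, β (e (k + d)) (e k))
    (sum_bilin_shift_eq he β)]

end FiniteFourier

/-! ### Commutator estimate for the powers of one invertible element -/

section CommutatorEstimate

variable {A : Type*} [NormedRing A] [NormedAlgebra ℂ A] {u : ℤ → A}

lemma norm_wienerEval_residueWeight_le (hu : ∀ n, ‖u n‖ ≤ 1) (N : ℕ) [NeZero N] (r : ZMod N) :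
    ‖wienerEval u (residueWeight N r)‖ ≤ 1 :=
  (norm_wienerEval_le hu (hasSum_norm_residueWeight N r).summable).trans_eq
    (hasSum_norm_residueWeight N r).tsum_eq

/-- The bilinear map `(x, y) ↦ (x T - T x) y`. -/
def commutatorMul (T : A) : A →ₗ[ℂ] A →ₗ[ℂ] A :=
  LinearMap.mk₂ ℂ (fun x y => (x * T - T * x) * y)
    (fun x x' y => by noncomm_ring)
    (fun c x y => by rw [smul_mul_assoc, mul_smul_comm, ← smul_sub, smul_mul_assoc])
    (fun x y y' => mul_add _ _ _)
    (fun c x y => mul_smul_comm _ _ _)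

@[simp] lemma commutatorMul_apply (T x y : A) :
    commutatorMul T x y = (x * T - T * x) * y := rfl

variable [CompleteSpace A]

lemma wienerEval_tentCoeff (hu : ∀ n, ‖u n‖ ≤ 1) (N : ℕ) [NeZero N] (j : ZMod N) :
    wienerEval u (tentCoeff N j) =
      ∑ r, (ZMod.stdAddChar (-(j * r)) / N : ℂ) • wienerEval u (residueWeight N r) :=
  wienerEval_sum_mul Finset.univ _ hu fun r => (hasSum_norm_residueWeight N r).summable

lemma norm_sum_stdAddChar_smul_le {N : ℕ} [NeZero N] {V : Type*} [NormedAddCommGroup V]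
    [NormedSpace ℂ V] {a : ZMod N → V} {C : ℝ} (ha : ∀ r, ‖a r‖ ≤ C) (j : ZMod N) :
    ‖∑ r, (ZMod.stdAddChar (-(j * r)) / N : ℂ) • a r‖ ≤ C := by
  have hN : (N : ℝ) ≠ 0 := Nat.cast_ne_zero.mpr (NeZero.ne N)
  refine (norm_sum_le_of_le _ (f := fun r => (ZMod.stdAddChar (-(j * r)) / N : ℂ) • a r)
    (n := fun _ => C / N) fun r _ => ?_).trans ?_
  · rw [norm_smul, norm_div, norm_stdAddChar, Complex.norm_natCast, div_mul_eq_mul_div, one_mul]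
    gcongr
    exact ha r
  · rw [Finset.sum_const, Finset.card_univ, ZMod.card, nsmul_eq_mul]
    field_simp
    exact le_rfl

lemma norm_wienerEval_tentCoeff_le (hu : ∀ n, ‖u n‖ ≤ 1) (N : ℕ) [NeZero N] (j : ZMod N) :
    ‖wienerEval u (tentCoeff N j)‖ ≤ 1 := by
  rw [wienerEval_tentCoeff hu]
  exact norm_sum_stdAddChar_smul_le (norm_wienerEval_residueWeight_le hu N) j

variable {T : A} {κ ε : ℝ}

lemma norm_stdAddChar_intCast_sub_one_le (N : ℕ) [NeZero N] (k : ℤ) :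
    ‖(ZMod.stdAddChar (k : ZMod N) - 1 : ℂ)‖ ≤ 2 * Real.pi / N * |(k : ℝ)| := by
  have h : (2 * Real.pi * Complex.I * k / N : ℂ) =
      Complex.I * ((2 * Real.pi / N * k : ℝ) : ℂ) := by
    push_cast; ring
  rw [ZMod.stdAddChar_coe, h]
  refine Real.norm_exp_I_mul_ofReal_sub_one_le.trans_eq ?_
  rw [norm_mul, Real.norm_of_nonneg (by positivity), Real.norm_eq_abs]

/-- Let `‖e T f‖ ≤ ε` whenever `e` and `f` come from disjoint tents, and let `T` commute with all
`u n` up to `κ`. Then the commutator of `T` with the first residue class is controlled by `ε`, up to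
a fixed proportion of `κ`. -/
theorem norm_commutatorMul_residueWeight_le (hu : ∀ n, ‖u n‖ ≤ 1)
    (hadd : ∀ m n, u (m + n) = u m * u n) (h0 : u 0 = 1)
    (hT : ∀ n, ‖u n * T - T * u n‖ ≤ κ) (N : ℕ) [NeZero N] (hN : 3 ≤ N)
    (hε : ∀ j k : ZMod N, wienerEval u (tentCoeff N j) * wienerEval u (tentCoeff N k) = 0 →
      ‖wienerEval u (tentCoeff N j) * T * wienerEval u (tentCoeff N k)‖ ≤ ε) :
    ‖commutatorMul T (wienerEval u (residueWeight N 1)) (wienerEval u (residueWeight N (-1)))‖ ≤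
      (N - 3) * (2 * (N * ε)) + 2 * (2 * Real.pi / N * κ) := by
  set a : ZMod N → A := fun r => wienerEval u (residueWeight N r) with ha
  set e : ZMod N → A := fun j => wienerEval u (tentCoeff N j) with he
  have hκ : 0 ≤ κ := (norm_nonneg _).trans (hT 0)
  have hae := wienerEval_tentCoeff hu N
  set G : ZMod N → A := fun d => ∑ k, commutatorMul T (e (k + d)) (e k) with hG
  have hβ : ∀ r, ‖commutatorMul T (a r) (a (-r))‖ ≤ κ := by
    intro r
    rw [commutatorMul_apply]
    refine (norm_mul_le _ _).trans ?_
    have h1 := norm_wienerEval_commutator_le hu hT (hasSum_norm_residueWeight N r).summable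
    rw [(hasSum_norm_residueWeight N r).tsum_eq, one_mul] at h1
    exact (mul_le_mul h1 (norm_wienerEval_residueWeight_le hu N (-r)) (norm_nonneg _) hκ).trans_eq
      (mul_one κ)
  -- `G d` is an average of the `β (a r) (a (-r))` with unimodular factors, so the bound does not
  -- grow with `N`.
  have hGκ : ∀ d, ‖G d‖ ≤ κ := by
    intro d
    simp only [hG]
    rw [sum_bilin_shift_eq hae]
    exact norm_sum_stdAddChar_smul_le hβ d
  have hGε : ∀ d, d ≠ 0 → d ≠ 1 → d ≠ -1 → ‖G d‖ ≤ N * ε := by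
    intro d hd0 hd1 hd2
    refine (norm_sum_le_of_le _ (n := fun _ => ε) fun k _ => ?_).trans ?_
    · have hz : e (k + d) * e k = 0 := by
        refine wienerEval_mul_eq_zero hu hadd (summable_norm_tentCoeff N _)
          (summable_norm_tentCoeff N _) (tsum_tentCoeff_mul_eq_zero N ?_ ?_ ?_)
        all_goals simpa using ‹_›
      rw [commutatorMul_apply, sub_mul, mul_assoc T, hz, mul_zero, sub_zero]
      exact hε _ _ hz
    · rw [Finset.sum_const, Finset.card_univ, ZMod.card, nsmul_eq_mul]
  -- Frequency 0 gives `∑ d, G d = 0`, because `a 0 = 1` commutes with `T`. Subtracting it kills the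
  -- offset `d = 0` and makes the coefficients at `d = ±1` of size `2π/N`.
  have h1 : commutatorMul T (a 1) (a (-1)) = ∑ d, (ZMod.stdAddChar d - 1 : ℂ) • G d := by
    have h2 : ∑ d, G d = 0 := by
      have := bilin_eq_sum_shift hae (commutatorMul T) 0
      simp only [mul_zero, AddChar.map_zero_eq_one, one_smul] at this
      rw [← this, commutatorMul_apply, residueWeight_zero, wienerEval_single, h0]
      simp
    simp_rw [sub_smul, one_smul]
    rw [Finset.sum_sub_distrib, h2, sub_zero, bilin_eq_sum_shift hae (commutatorMul T) 1]
    simp only [mul_one, hG, he]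
  have h3 : (1 : ZMod N) ≠ 0 := by
    intro h
    have := (ZMod.natCast_eq_zero_iff 1 N).mp (by exact_mod_cast h)
    exact absurd (Nat.le_of_dvd one_pos this) (by omega)
  have h4 : (1 : ZMod N) ≠ -1 := by
    intro h
    have h5 : ((2 : ℕ) : ZMod N) = 0 := by
      rw [← sub_eq_zero] at h
      rw [← h]; push_cast; ring
    exact absurd (Nat.le_of_dvd two_pos ((ZMod.natCast_eq_zero_iff 2 N).mp h5)) (by omega)
  have hmem : ∀ d, d ∈ ({0, 1, -1} : Finset (ZMod N)) ↔ d = 0 ∨ d = 1 ∨ d = -1 := by simp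
  have hcard : ({0, 1, -1} : Finset (ZMod N)).card = 3 := by
    rw [Finset.card_eq_three]
    exact ⟨0, 1, -1, h3.symm, (neg_ne_zero.mpr h3).symm, h4, rfl⟩
  rw [h1, ← Finset.sum_compl_add_sum ({0, 1, -1} : Finset (ZMod N))]
  refine (norm_add_le _ _).trans (add_le_add ?_ ?_)
  · refine (norm_sum_le_of_le _ (n := fun _ => 2 * (N * ε)) fun d hd => ?_).trans_eq ?_
    · rw [Finset.mem_compl, hmem] at hd
      push Not at hd
      rw [norm_smul]
      refine mul_le_mul ?_ (hGε d hd.1 hd.2.1 hd.2.2) (norm_nonneg _) zero_le_two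
      refine (norm_sub_le _ _).trans_eq ?_
      rw [norm_stdAddChar, norm_one]
      norm_num
    · rw [Finset.sum_const, Finset.card_compl, hcard, ZMod.card, nsmul_eq_mul, Nat.cast_sub hN]
      norm_num
  · rw [Finset.sum_insert (by simp [h3, h3.symm]), Finset.sum_pair h4, AddChar.map_zero_eq_one,
      sub_self, zero_smul, zero_add, two_mul]
    refine (norm_add_le _ _).trans (add_le_add ?_ ?_)
    · rw [norm_smul]
      refine mul_le_mul ?_ (hGκ 1) (norm_nonneg _) (by positivity)
      simpa using norm_stdAddChar_intCast_sub_one_le N 1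
    · rw [norm_smul]
      refine mul_le_mul ?_ (hGκ (-1)) (norm_nonneg _) (by positivity)
      simpa using norm_stdAddChar_intCast_sub_one_le N (-1)

/-- From `sin x ≥ x - x³/6` and `1 - s² ≤ 2(1 - s)`. -/
lemma one_sub_fejerWeight_one_le (N : ℕ) [NeZero N] :
    1 - fejerWeight N 1 ≤ (Real.pi / N) ^ 2 / 3 := by
  have hN : (0 : ℝ) < N := by exact_mod_cast NeZero.pos N
  set x := Real.pi / N with hx
  have hx0 : 0 < x := div_pos Real.pi_pos hN
  have h1 : fejerWeight N 1 = Real.sinc x ^ 2 := by simp [fejerWeight, hx]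
  rw [h1, Real.sinc_of_ne_zero hx0.ne']
  have h2 : 1 - x ^ 2 / 6 ≤ Real.sin x / x := by
    rw [le_div_iff₀ hx0]
    linarith [Real.sin_gt_sub_cube hx0, show (1 - x ^ 2 / 6) * x = x - x ^ 3 / 6 by ring]
  nlinarith [sq_nonneg (Real.sin x / x - 1)]

lemma fejerWeight_neg (N : ℕ) (n : ℤ) : fejerWeight N (-n) = fejerWeight N n := by
  rw [fejerWeight, fejerWeight, ← Real.sinc_neg]
  push_cast
  ring_nf

/-- If `‖e T f‖ ≤ ε` whenever `e` and `f` come from disjoint tents, and `T` commutes with all `u n`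
up to `κ`, then it commutes with `u 1` up to a multiple of `ε` and a fixed proportion of `κ`. -/
theorem norm_conj_sub_le (hu : ∀ n, ‖u n‖ ≤ 1)
    (hadd : ∀ m n, u (m + n) = u m * u n) (h0 : u 0 = 1)
    (hT : ∀ n, ‖u n * T - T * u n‖ ≤ κ) (N : ℕ) [NeZero N] (hN : 3 ≤ N)
    (hε : ∀ j k : ZMod N, wienerEval u (tentCoeff N j) * wienerEval u (tentCoeff N k) = 0 →
      ‖wienerEval u (tentCoeff N j) * T * wienerEval u (tentCoeff N k)‖ ≤ ε) :
    ‖u 1 * T * u (-1) - T‖ ≤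
      (N - 3) * (2 * (N * ε)) + (4 * Real.pi / N + 4 / 3 * (Real.pi / N) ^ 2) * κ := by
  have hκ : 0 ≤ κ := (norm_nonneg _).trans (hT 0)
  set δ := 2 * (1 - fejerWeight N 1) with hδ
  have hδ' : δ ≤ 2 / 3 * (Real.pi / N) ^ 2 := by linarith [one_sub_fejerWeight_one_le N]
  have hs : ∀ k : ℤ, Summable fun n : ℤ => ‖(if n = k then (1 : ℂ) else 0)‖ := fun k =>
    (hasSum_ite_eq k (1 : ℝ)).summable.congr fun n => by split_ifs <;> simp
  have hsub : ∀ k : ℤ, wienerEval u (fun n => residueWeight N k n - if n = k then 1 else 0) =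
      wienerEval u (residueWeight N k) - u k := fun k => by
    rw [wienerEval_sub hu (hasSum_norm_residueWeight N k).summable (hs k), wienerEval_single]
  set p := wienerEval u (residueWeight N 1) with hp
  set q := wienerEval u (residueWeight N (-1)) with hq
  have hp1 : ‖(p - u 1) * T - T * (p - u 1)‖ ≤ δ * κ := by
    have h := norm_wienerEval_commutator_le hu hT (hasSum_norm_residueWeight_sub N 1).summable
    rw [(hasSum_norm_residueWeight_sub N 1).tsum_eq, hsub] at h
    simpa using h
  have hq1 : ‖q - u (-1)‖ ≤ δ := by
    have h := norm_wienerEval_le hu (hasSum_norm_residueWeight_sub N (-1)).summable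
    rw [(hasSum_norm_residueWeight_sub N (-1)).tsum_eq, hsub, fejerWeight_neg] at h
    simpa using h
  have hp2 : ‖p * T - T * p‖ ≤ κ := by
    have h := norm_wienerEval_commutator_le hu hT (hasSum_norm_residueWeight N 1).summable
    rwa [(hasSum_norm_residueWeight N 1).tsum_eq, one_mul] at h
  have hmain := norm_commutatorMul_residueWeight_le hu hadd h0 hT N hN hε
  rw [commutatorMul_apply, ← hp, ← hq] at hmain
  have hu1 : u 1 * u (-1) = 1 := by rw [← hadd, add_neg_cancel, h0]
  have hid : u 1 * T * u (-1) - T = (p * T - T * p) * q -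
      ((p - u 1) * T - T * (p - u 1)) * u (-1) - (p * T - T * p) * (q - u (-1)) := by
    have : u 1 * T * u (-1) - T = (u 1 * T - T * u 1) * u (-1) := by
      rw [sub_mul, mul_assoc T, hu1, mul_one]
    rw [this]
    noncomm_ring
  rw [hid]
  have e1 : ‖((p - u 1) * T - T * (p - u 1)) * u (-1)‖ ≤ δ * κ :=
    (norm_mul_le _ _).trans <| (mul_le_of_le_one_right (norm_nonneg _) (hu _)).trans hp1
  have e2 : ‖(p * T - T * p) * (q - u (-1))‖ ≤ κ * δ :=
    (norm_mul_le _ _).trans (mul_le_mul hp2 hq1 (norm_nonneg _) hκ)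
  have e3 : δ * κ ≤ 2 / 3 * (Real.pi / N) ^ 2 * κ := mul_le_mul_of_nonneg_right hδ' hκ
  have e4 := norm_sub_le ((p * T - T * p) * q - ((p - u 1) * T - T * (p - u 1)) * u (-1))
    ((p * T - T * p) * (q - u (-1)))
  have e5 := norm_sub_le ((p * T - T * p) * q) (((p - u 1) * T - T * (p - u 1)) * u (-1))
  calc _ ≤ _ := e4
    _ ≤ (N - 3) * (2 * (N * ε)) + 2 * (2 * Real.pi / N * κ) + δ * κ + κ * δ := by linarith
    _ ≤ _ := by
      have : 2 * (2 * Real.pi / N * κ) = 4 * Real.pi / N * κ := by ring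
      rw [this]
      linarith

end CommutatorEstimate

/-! ### Homogeneity of the pointwise distance -/

section ReflexiveDist

variable {X : Type*} [NormedAddCommGroup X] [NormedSpace ℂ X]

lemma zero_mem_opOrbit (𝒮 : Submodule ℂ (X →L[ℂ] X)) (x : X) : (0 : X) ∈ opOrbit 𝒮 x :=
  ⟨0, 𝒮.zero_mem, rfl⟩

lemma bddAbove_infDist_opOrbit (𝒮 : Submodule ℂ (X →L[ℂ] X)) (T : X →L[ℂ] X) :
    BddAbove (Set.range fun x : Metric.closedBall (0 : X) 1 =>
      Metric.infDist (T x) (opOrbit 𝒮 x)) := by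
  refine ⟨‖T‖, ?_⟩
  rintro _ ⟨x, rfl⟩
  have hx : ‖(x : X)‖ ≤ 1 := mem_closedBall_zero_iff.mp x.2
  refine (Metric.infDist_le_dist_of_mem (zero_mem_opOrbit 𝒮 (x : X))).trans ?_
  rw [dist_zero_right]
  exact T.unit_le_opNorm _ hx

lemma reflexiveDist_nonneg (𝒮 : Submodule ℂ (X →L[ℂ] X)) (T : X →L[ℂ] X) :
    0 ≤ reflexiveDist 𝒮 T := Real.iSup_nonneg fun _ => Metric.infDist_nonneg

lemma infDist_opOrbit_le (𝒮 : Submodule ℂ (X →L[ℂ] X)) (T : X →L[ℂ] X) (x : X) :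
    Metric.infDist (T x) (opOrbit 𝒮 x) ≤ reflexiveDist 𝒮 T * ‖x‖ := by
  rcases eq_or_ne x 0 with rfl | hx
  · simpa using Metric.infDist_le_dist_of_mem (x := T 0) (zero_mem_opOrbit 𝒮 (0 : X))
  have hx' : 0 < ‖x‖ := norm_pos_iff.mpr hx
  set c : ℂ := (‖x‖ : ℂ)⁻¹ with hc
  have hcn : ‖c‖ = ‖x‖⁻¹ := by simp [hc]
  have hy : c • x ∈ Metric.closedBall (0 : X) 1 := by
    rw [mem_closedBall_zero_iff, norm_smul, hcn, inv_mul_cancel₀ hx'.ne']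
  have h1 : Metric.infDist (T (c • x)) (opOrbit 𝒮 (c • x)) ≤ reflexiveDist 𝒮 T :=
    le_ciSup (bddAbove_infDist_opOrbit 𝒮 T) ⟨c • x, hy⟩
  rw [← div_le_iff₀ hx']
  refine le_trans ?_ h1
  refine (Metric.le_infDist ⟨0, zero_mem_opOrbit 𝒮 _⟩).mpr ?_
  rintro _ ⟨S, hS, rfl⟩
  rw [div_le_iff₀ hx']
  refine (Metric.infDist_le_dist_of_mem (x := T x) (⟨S, hS, rfl⟩ : S x ∈ opOrbit 𝒮 x)).trans_eq ?_
  simp only [map_smul]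
  rw [dist_smul₀, hcn]
  field_simp

end ReflexiveDist

/-! ### Almost commutation with an isometric representation -/

section Representation

variable {G : Type*} [Group G] {X : Type*} [NormedAddCommGroup X] [NormedSpace ℂ X]

/-- `E` annihilates `S (F x)` for every `S ∈ 𝒮`, so `E (T (F x)) = E (T (F x) - S (F x))`, with `S`
free to depend on `x`. -/
lemma norm_mul_mul_le_of_commute {𝒮 : Submodule ℂ (X →L[ℂ] X)} {T E F : X →L[ℂ] X} {ε : ℝ}
    (hT : ∀ x, Metric.infDist (T x) (opOrbit 𝒮 x) ≤ ε * ‖x‖) (hε : 0 ≤ ε) (hE : ‖E‖ ≤ 1)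
    (hF : ‖F‖ ≤ 1) (hEF : E * F = 0) (hSF : ∀ S ∈ 𝒮, Commute S F) : ‖E * T * F‖ ≤ ε := by
  refine ContinuousLinearMap.opNorm_le_bound _ hε fun x => ?_
  have h1 : ‖(E * T * F) x‖ ≤ Metric.infDist (T (F x)) (opOrbit 𝒮 (F x)) := by
    refine (Metric.le_infDist ⟨0, zero_mem_opOrbit 𝒮 _⟩).mpr ?_
    rintro _ ⟨S, hS, rfl⟩
    have h2 : E (S (F x)) = 0 := by
      have h3 : E * (S * F) = 0 := by rw [(hSF S hS).eq, ← mul_assoc, hEF, zero_mul]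
      exact congrArg (fun R : X →L[ℂ] X => R x) h3
    have h4 : (E * T * F) x = E (T (F x) - S (F x)) := by
      rw [map_sub, h2, sub_zero]; rfl
    rw [h4, dist_eq_norm]
    exact (E.le_opNorm _).trans (mul_le_of_le_one_left (norm_nonneg _) hE)
  refine h1.trans ((hT _).trans (mul_le_mul_of_nonneg_left ?_ hε))
  exact (F.le_opNorm _).trans (mul_le_of_le_one_left (norm_nonneg _) hF)

/-- For `N = 20` the coefficient of `ε` is `17 · 2 · 20 = 680`, and the proportion of `κ` to be
absorbed is just below `2/3`. -/
lemma le_mul_one_sub_errorRatio :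
    680 ≤ 288 * Real.pi * (1 + √2) *
      (1 - (4 * Real.pi / 20 + 4 / 3 * (Real.pi / 20) ^ 2)) := by
  have h1 := Real.pi_gt_d2
  have h2 := Real.pi_lt_d2
  have h3 : (1.41 : ℝ) ≤ √2 := Real.le_sqrt_of_sq_le (by norm_num)
  have h4 : (1 / 3 : ℝ) ≤ 1 - (4 * Real.pi / 20 + 4 / 3 * (Real.pi / 20) ^ 2) := by nlinarith
  have h5 : (2040 : ℝ) ≤ 288 * Real.pi * (1 + √2) := by nlinarith
  calc (680 : ℝ) = 2040 * (1 / 3) := by norm_num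
    _ ≤ _ := mul_le_mul h5 h4 (by norm_num) (by linarith)

/-- An operator that is pointwise close to operators commuting with an isometric group
representation almost commutes with the representation. -/
theorem norm_conj_sub_le_of_infDist_le [CompleteSpace X] (ρ : G →* (X →L[ℂ] X))
    (hρ : ∀ t, ‖ρ t‖ ≤ 1) {𝒮 : Submodule ℂ (X →L[ℂ] X)} (h𝒮 : ∀ S ∈ 𝒮, ∀ t, Commute S (ρ t))
    {T : X →L[ℂ] X} {ε : ℝ} (hε : 0 ≤ ε)
    (hT : ∀ x, Metric.infDist (T x) (opOrbit 𝒮 x) ≤ ε * ‖x‖) (t : G) :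
    ‖ρ t * T * ρ t⁻¹ - T‖ ≤ 288 * Real.pi * (1 + √2) * ε := by
  -- A priori finiteness of the supremum is what permits absorbing it into the left side.
  have hbd : BddAbove (Set.range fun t => ‖ρ t * T * ρ t⁻¹ - T‖) := by
    refine ⟨1 * ‖T‖ * 1 + ‖T‖, ?_⟩
    rintro _ ⟨s, rfl⟩
    refine (norm_sub_le _ _).trans (add_le_add_left ?_ _)
    refine (norm_mul_le _ _).trans (mul_le_mul ?_ (hρ _) (norm_nonneg _) (by positivity))
    exact (norm_mul_le _ _).trans (mul_le_mul_of_nonneg_right (hρ s) (norm_nonneg _))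
  set κ := ⨆ t, ‖ρ t * T * ρ t⁻¹ - T‖ with hκ
  have hκt : ∀ s, ‖ρ s * T * ρ s⁻¹ - T‖ ≤ κ := fun s => le_ciSup hbd s
  have hcomm : ∀ s, ‖ρ s * T - T * ρ s‖ ≤ κ := by
    intro s
    have h1 : ρ s⁻¹ * ρ s = 1 := by rw [← map_mul, inv_mul_cancel, map_one]
    have h2 : ρ s * T - T * ρ s = (ρ s * T * ρ s⁻¹ - T) * ρ s := by
      rw [sub_mul, mul_assoc (ρ s * T), h1, mul_one]
    rw [h2]
    exact (norm_mul_le _ _).trans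
      ((mul_le_of_le_one_right (norm_nonneg _) (hρ s)).trans (hκt s))
  have hstep : ∀ s, ‖ρ s * T * ρ s⁻¹ - T‖ ≤
      680 * ε + (4 * Real.pi / 20 + 4 / 3 * (Real.pi / 20) ^ 2) * κ := by
    intro s
    have hu : ∀ n : ℤ, ‖ρ (s ^ n)‖ ≤ 1 := fun n => hρ _
    have h := norm_conj_sub_le (u := fun n : ℤ => ρ (s ^ n)) (T := T) (κ := κ) (ε := ε) hu
      (fun m n => by simp only [zpow_add, map_mul]) (by simp) (fun n => hcomm _) 20 (by norm_num)
      (fun j k hjk => norm_mul_mul_le_of_commute hT hε (norm_wienerEval_tentCoeff_le hu 20 j)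
        (norm_wienerEval_tentCoeff_le hu 20 k) hjk fun S hS =>
          Commute.wienerEval_right hu (fun n => h𝒮 S hS _) (summable_norm_tentCoeff 20 k))
    simp only [zpow_one, zpow_neg] at h
    refine h.trans_eq ?_
    push_cast
    ring
  have hκ' : κ ≤ 680 * ε + (4 * Real.pi / 20 + 4 / 3 * (Real.pi / 20) ^ 2) * κ := ciSup_le hstep
  have hq := le_mul_one_sub_errorRatio
  set q := 4 * Real.pi / 20 + 4 / 3 * (Real.pi / 20) ^ 2 with hqdef
  set K := 288 * Real.pi * (1 + √2) with hK
  have hK0 : 0 < K := by positivity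
  have hq1 : 0 < 1 - q := by
    by_contra hcon
    have := mul_nonpos_of_nonneg_of_nonpos hK0.le (not_lt.mp hcon)
    linarith
  refine (hκt t).trans ?_
  have h1 : (1 - q) * κ ≤ (1 - q) * (K * ε) := by
    calc (1 - q) * κ ≤ 680 * ε := by linarith
      _ ≤ K * (1 - q) * ε := mul_le_mul_of_nonneg_right hq hε
      _ = _ := by ring
  exact le_of_mul_le_mul_left h1 hq1

end Representation

/-! ### Goldstine and Milman–Pettis -/

section MilmanPettis

variable {E : Type*} [NormedAddCommGroup E] [NormedSpace ℂ E]

lemma StrongDual.norm_le_of_re_le {f : StrongDual ℂ E} {c : ℝ} (hc : 0 ≤ c)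
    (h : ∀ x, ‖x‖ ≤ 1 → (f x).re ≤ c) : ‖f‖ ≤ c := by
  refine ContinuousLinearMap.opNorm_le_of_unit_norm hc fun x hx => ?_
  rcases eq_or_ne (f x) 0 with h0 | h0
  · rw [h0, norm_zero]; exact hc
  have hn : (‖f x‖ : ℂ) ≠ 0 := by simpa using h0
  have h1 : (starRingEnd ℂ (f x) / ‖f x‖) * f x = (‖f x‖ : ℂ) := by
    rw [div_mul_eq_mul_div, mul_comm, Complex.mul_conj, Complex.normSq_eq_norm_sq]
    push_cast
    field_simp
  have h2 := h ((starRingEnd ℂ (f x) / ‖f x‖) • x) (by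
    rw [norm_smul, norm_div, RCLike.norm_conj, Complex.norm_real, norm_norm, div_self
      (by simpa using h0), hx, one_mul])
  rw [map_smul, smul_eq_mul, h1, Complex.ofReal_re] at h2
  exact h2

/-- **Goldstine's theorem**: the unit ball is weak-* dense in the unit ball of the double dual. -/
theorem mem_closure_image_closedBall {Y : Type*} [NormedAddCommGroup Y] [NormedSpace ℂ Y]
    (j : E →ₗ[ℂ] Y →ₗ[ℂ] ℂ)
    (hj : ∀ (φ : Y) (c : ℝ), 0 ≤ c → (∀ x, ‖x‖ ≤ 1 → (j x φ).re ≤ c) → ‖φ‖ ≤ c)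
    {Ψ : Y →ₗ[ℂ] ℂ} (hΨ : ∀ φ, ‖Ψ φ‖ ≤ ‖φ‖) :
    (fun φ => Ψ φ) ∈ closure ((fun (x : E) (φ : Y) => j x φ) '' Metric.closedBall (0 : E) 1) := by
  -- The algebraic dual of `Y` with the topology of pointwise convergence: its continuous
  -- functionals are the evaluations at points of `Y`, so a separating functional is some `φ : Y`.
  let B : (Y →ₗ[ℂ] ℂ) →ₗ[ℂ] Y →ₗ[ℂ] ℂ := LinearMap.id
  let j' : E → WeakBilin B := fun x => j x
  let Ψ' : WeakBilin B := Ψ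
  suffices h : Ψ' ∈ closure (j' '' Metric.closedBall (0 : E) 1) by
    have h1 := mem_closure_image (WeakBilin.coeFn_continuous B).continuousAt h
    rw [Set.image_image] at h1
    exact h1
  by_contra hcon
  have hconv : Convex ℝ (j' '' Metric.closedBall (0 : E) 1) := by
    rintro _ ⟨x, hx, rfl⟩ _ ⟨y, hy, rfl⟩ a b ha hb hab
    refine ⟨a • x + b • y, convex_closedBall _ _ hx hy ha hb hab, ?_⟩
    change j (a • x + b • y) = a • j x + b • j y
    ext φ
    simp only [← Complex.coe_smul, map_add, map_smul, LinearMap.add_apply, LinearMap.smul_apply]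
  have : ContinuousSMul ℝ (WeakBilin B) := IsScalarTower.continuousSMul ℂ
  obtain ⟨f, u, hf, hfu⟩ := RCLike.geometric_hahn_banach_closed_point (𝕜 := ℂ) hconv.closure
    isClosed_closure hcon
  obtain ⟨φ, rfl⟩ := LinearMap.dualEmbedding_surjective _ f
  have h1 : ∀ x : E, ‖x‖ ≤ 1 → (j x φ).re ≤ u := fun x hx =>
    (hf _ (subset_closure ⟨x, mem_closedBall_zero_iff.mpr hx, rfl⟩)).le
  have h2 : u < (Ψ φ).re := hfu
  have hu : 0 ≤ u := by simpa using h1 0 (by simp)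
  have h3 := hj φ u hu h1
  have h4 := (Complex.re_le_norm _).trans (hΨ φ)
  linarith

/-- **Milman–Pettis theorem**: a uniformly convex Banach space is reflexive. -/
theorem inclusionInDoubleDual_surjective [CompleteSpace E] [UniformConvexSpace E] :
    Function.Surjective (NormedSpace.inclusionInDoubleDual ℂ E) := by
  suffices h : ∀ Ψ : StrongDual ℂ (StrongDual ℂ E), ‖Ψ‖ = 1 →
      ∃ x, NormedSpace.inclusionInDoubleDual ℂ E x = Ψ by
    intro Ψ
    rcases eq_or_ne Ψ 0 with rfl | h0
    · exact ⟨0, map_zero _⟩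
    have hn : ‖Ψ‖ ≠ 0 := fun h' => h0 <| ContinuousLinearMap.ext fun φ =>
      norm_le_zero_iff.mp ((Ψ.le_opNorm φ).trans_eq (by rw [h', zero_mul]))
    have hn' : (‖Ψ‖ : ℂ) ≠ 0 := Complex.ofReal_ne_zero.mpr hn
    have hle : ‖(‖Ψ‖ : ℂ)⁻¹ • Ψ‖ = 1 := by
      have h1 : ‖(‖Ψ‖ : ℂ)⁻¹‖ = ‖Ψ‖⁻¹ := by
        rw [norm_inv, Complex.norm_real, Real.norm_of_nonneg (ContinuousLinearMap.opNorm_nonneg Ψ)]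
      refine le_antisymm ?_ ?_
      · refine (ContinuousLinearMap.opNorm_smul_le _ _).trans_eq ?_
        rw [h1, inv_mul_cancel₀ hn]
      · have h2 := ContinuousLinearMap.opNorm_smul_le (‖Ψ‖ : ℂ) ((‖Ψ‖ : ℂ)⁻¹ • Ψ)
        rw [smul_smul, mul_inv_cancel₀ hn', one_smul, Complex.norm_real,
          Real.norm_of_nonneg (ContinuousLinearMap.opNorm_nonneg Ψ)] at h2
        have h3 : 0 < ‖Ψ‖ := lt_of_le_of_ne (ContinuousLinearMap.opNorm_nonneg Ψ) hn.symm
        exact le_of_mul_le_mul_left (by simpa using h2) h3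
    obtain ⟨x, hx⟩ := h _ hle
    refine ⟨(‖Ψ‖ : ℂ) • x, ?_⟩
    rw [map_smul, hx, smul_smul, mul_inv_cancel₀ hn', one_smul]
  intro Ψ hΨ
  let j : E → StrongDual ℂ E → ℂ := fun x φ => φ x
  let F : Filter E := Filter.comap j (nhds fun φ => Ψ φ) ⊓ Filter.principal (Metric.closedBall 0 1)
  have hne : F.NeBot := by
    have h := mem_closure_image_closedBall (E := E) (Y := StrongDual ℂ E)
      (LinearMap.mk₂ ℂ (fun x φ => φ x) (fun x y φ => map_add φ x y) (fun c x φ => map_smul φ c x)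
        (fun x φ ψ => rfl) (fun c x φ => rfl))
      (fun φ c hc h => StrongDual.norm_le_of_re_le hc h) (Ψ := (Ψ : StrongDual ℂ E →ₗ[ℂ] ℂ))
      (fun φ => (Ψ.le_opNorm φ).trans_eq (by rw [hΨ, one_mul]))
    rw [mem_closure_iff_nhdsWithin_neBot, nhdsWithin] at h
    have h' : (nhds (fun φ => Ψ φ) ⊓ Filter.principal (j '' Metric.closedBall 0 1)).NeBot := h
    rw [← Filter.map_principal, ← Filter.push_pull'] at h'
    exact Filter.map_neBot_iff _ |>.mp h'
  have hball : Metric.closedBall (0 : E) 1 ∈ F :=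
    Filter.mem_inf_of_right (Filter.mem_principal_self _)
  have hlim : ∀ φ : StrongDual ℂ E, Filter.Tendsto φ F (nhds (Ψ φ)) := by
    intro φ
    have h1 : Filter.Tendsto j F (nhds fun φ => Ψ φ) := Filter.tendsto_comap.mono_left inf_le_left
    exact ((continuous_apply φ).tendsto _).comp h1
  have hcauchy : Cauchy F := by
    rw [Metric.cauchy_iff]
    refine ⟨hne, fun ε hε => ?_⟩
    obtain ⟨δ, hδ, hconv⟩ := exists_forall_closed_ball_dist_add_le_two_sub E hε
    -- Where `Re φ > 1 - δ/4`, two points of the ball have `‖x + y‖ > 2 - δ/2`, so uniform convexity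
    -- makes them `ε`-close. The minimum with 1 keeps the bound nonnegative.
    obtain ⟨φ, hφ, hφΨ⟩ : ∃ φ : StrongDual ℂ E, ‖φ‖ ≤ 1 ∧ 1 - min (δ / 4) 1 < (Ψ φ).re := by
      by_contra! hcon
      have := StrongDual.norm_le_of_re_le (by simp) hcon
      rw [hΨ] at this
      have : 0 < min (δ / 4) 1 := by positivity
      linarith
    have hφΨ' : 1 - δ / 4 < (Ψ φ).re := lt_of_le_of_lt (by linarith [min_le_left (δ / 4) 1]) hφΨ
    have hev : ∀ᶠ x in F, 1 - δ / 4 < (φ x).re :=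
      ((Complex.continuous_re.tendsto _).comp (hlim φ)).eventually (lt_mem_nhds hφΨ')
    refine ⟨_, Filter.inter_mem hev hball, fun x hx y hy => ?_⟩
    by_contra! hxy
    rw [dist_eq_norm] at hxy
    have h1 := hconv (mem_closedBall_zero_iff.mp hx.2) (mem_closedBall_zero_iff.mp hy.2) hxy
    have h2 : (φ (x + y)).re ≤ ‖x + y‖ := (Complex.re_le_norm _).trans <|
      (φ.le_opNorm _).trans (mul_le_of_le_one_left (norm_nonneg _) hφ)
    have h3 : 1 - δ / 4 < (φ x).re := hx.1
    have h4 : 1 - δ / 4 < (φ y).re := hy.1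
    rw [map_add, Complex.add_re] at h2
    linarith
  obtain ⟨x, hx⟩ := CompleteSpace.complete hcauchy
  refine ⟨x, ContinuousLinearMap.ext fun φ => ?_⟩
  exact tendsto_nhds_unique ((φ.continuous.tendsto x).mono_left hx) (hlim φ)

end MilmanPettis

/-! ### Averaging over an amenable group -/

section Averaging

variable {G : Type*} [Group G] [TopologicalSpace G] [IsTopologicalGroup G]
  {X : Type*} [NormedAddCommGroup X] [NormedSpace ℂ X]

lemma continuous_conj_apply {ρ : G →* (X →L[ℂ] X)} (hρ : ∀ t, ‖ρ t‖ ≤ 1)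
    (hcont : ∀ x, Continuous fun t => ρ t x) (T : X →L[ℂ] X) (x : X) :
    Continuous fun t => ρ t (T (ρ t⁻¹ x)) := by
  have hy : Continuous fun t => T (ρ t⁻¹ x) := T.continuous.comp ((hcont x).comp continuous_inv)
  rw [continuous_iff_continuousAt]
  intro s
  rw [ContinuousAt, tendsto_iff_norm_sub_tendsto_zero]
  have h1 : Filter.Tendsto (fun t => ‖T (ρ t⁻¹ x) - T (ρ s⁻¹ x)‖ +
      ‖ρ t (T (ρ s⁻¹ x)) - ρ s (T (ρ s⁻¹ x))‖) (nhds s) (nhds (0 + 0)) :=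
    (tendsto_iff_norm_sub_tendsto_zero.mp (hy.tendsto s)).add
      (tendsto_iff_norm_sub_tendsto_zero.mp ((hcont _).tendsto s))
  rw [add_zero] at h1
  refine squeeze_zero (fun _ => norm_nonneg _) (fun t => ?_) h1
  have h2 : ρ t (T (ρ t⁻¹ x)) - ρ s (T (ρ s⁻¹ x)) = ρ t (T (ρ t⁻¹ x) - T (ρ s⁻¹ x)) +
      (ρ t (T (ρ s⁻¹ x)) - ρ s (T (ρ s⁻¹ x))) := by rw [map_sub]; abel
  rw [h2]
  refine (norm_add_le _ _).trans (add_le_add_left ?_ _)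
  exact ((ρ t).le_opNorm _).trans (mul_le_of_le_one_left (norm_nonneg _) (hρ t))

/-- The matrix coefficients `t ↦ φ (ρ t T ρ t⁻¹ x)` as bounded continuous functions. -/
def conjCoeff {ρ : G →* (X →L[ℂ] X)} (hρ : ∀ t, ‖ρ t‖ ≤ 1)
    (hcont : ∀ x, Continuous fun t => ρ t x) (T : X →L[ℂ] X) (x : X) (φ : StrongDual ℂ X) :
    G →ᵇ ℂ :=
  BoundedContinuousFunction.ofNormedAddCommGroup (fun t => φ (ρ t (T (ρ t⁻¹ x))))
    (φ.continuous.comp (continuous_conj_apply hρ hcont T x)) (‖φ‖ * (‖T‖ * ‖x‖)) fun t => by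
      refine (φ.le_opNorm _).trans (mul_le_mul_of_nonneg_left ?_ (norm_nonneg _))
      refine ((ρ t).le_opNorm _).trans ((mul_le_of_le_one_left (norm_nonneg _) (hρ t)).trans ?_)
      refine (T.le_opNorm _).trans (mul_le_mul_of_nonneg_left ?_ (norm_nonneg _))
      exact ((ρ t⁻¹).le_opNorm _).trans (mul_le_of_le_one_left (norm_nonneg _) (hρ _))

/-- Averaging of an operator over an amenable group, for a representation on a reflexive space. -/
theorem exists_commute_norm_sub_le
    (hX : Function.Surjective (NormedSpace.inclusionInDoubleDual ℂ X))
    {ρ : G →* (X →L[ℂ] X)} (hρ : ∀ t, ‖ρ t‖ ≤ 1) (hcont : ∀ x, Continuous fun t => ρ t x)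
    (hG : IsAmenableGroup G) (T : X →L[ℂ] X) {c : ℝ} (hc : ∀ t, ‖ρ t * T * ρ t⁻¹ - T‖ ≤ c) :
    ∃ S : X →L[ℂ] X, (∀ t, Commute S (ρ t)) ∧ ‖T - S‖ ≤ c := by
  obtain ⟨m, hm, hm1, hinv⟩ := hG
  have hc0 : 0 ≤ c := (norm_nonneg _).trans (hc 1)
  let F := conjCoeff hρ hcont T
  have hF : ∀ x φ t, F x φ t = φ (ρ t (T (ρ t⁻¹ x))) := fun _ _ _ => rfl
  let B : X →L[ℂ] StrongDual ℂ X →L[ℂ] ℂ := LinearMap.mkContinuous₂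
    (LinearMap.mk₂ ℂ (fun x φ => m (F x φ))
      (fun x y φ => by rw [← map_add]; congr 1; ext t; simp [hF])
      (fun a x φ => by rw [← map_smul]; congr 1; ext t; simp [hF])
      (fun x φ ψ => by rw [← map_add]; congr 1)
      (fun a x φ => by rw [← map_smul]; congr 1)) ‖T‖ fun x φ => by
        refine (m.le_opNorm _).trans ?_
        rw [hm, one_mul]
        refine (BoundedContinuousFunction.norm_ofNormedAddCommGroup_le _ (by positivity) _).trans_eq ?_
        ring
  -- The mean of the coefficients at `x` is only an element of the bidual; reflexivity turns it into
  -- a vector `S x`.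
  let e : X ≃ₗᵢ[ℂ] StrongDual ℂ (StrongDual ℂ X) :=
    LinearIsometryEquiv.ofSurjective (NormedSpace.inclusionInDoubleDualLi ℂ) hX
  let S : X →L[ℂ] X := (e.symm : StrongDual ℂ (StrongDual ℂ X) →L[ℂ] X).comp B
  have hS : ∀ x (φ : StrongDual ℂ X), φ (S x) = m (F x φ) := by
    intro x φ
    have h : e (S x) = B x := e.apply_symm_apply (B x)
    exact congrArg (fun Φ : StrongDual ℂ (StrongDual ℂ X) => Φ φ) h
  refine ⟨S, fun s => ?_, ?_⟩
  · refine ContinuousLinearMap.ext fun x =>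
      SeparatingDual.eq_iff_forall_dual_eq (R := ℂ) |>.mpr fun φ => ?_
    change φ (S (ρ s x)) = (φ.comp (ρ s)) (S x)
    -- Invariance replaces `t` by `s * t`, and `(s * t)⁻¹ * s = t⁻¹`.
    rw [hS, hS, ← hinv s]
    congr 1
    ext t
    change φ (ρ (s * t) (T (ρ (s * t)⁻¹ (ρ s x)))) = φ (ρ s (ρ t (T (ρ t⁻¹ x))))
    have h1 : ρ (s * t)⁻¹ (ρ s x) = ρ t⁻¹ x := by
      rw [← mul_apply_eq_comp, ← map_mul]; simp
    rw [h1, map_mul]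
    rfl
  · refine ContinuousLinearMap.opNorm_le_bound _ hc0 fun x => ?_
    refine NormedSpace.norm_le_dual_bound ℂ _ (by positivity) fun φ => ?_
    have h1 : φ ((T - S) x) = m (φ (T x) • 1 - F x φ) := by
      rw [map_sub, map_smul, hm1, smul_eq_mul, mul_one, ← hS, ← map_sub]; rfl
    rw [h1]
    refine (m.le_opNorm _).trans ?_
    rw [hm, one_mul, BoundedContinuousFunction.norm_le (by positivity)]
    intro t
    have h2 : (φ (T x) • (1 : G →ᵇ ℂ) - F x φ) t = -φ ((ρ t * T * ρ t⁻¹ - T) x) := by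
      simp [hF]
    rw [h2, norm_neg, mul_comm (c * ‖x‖)]
    refine (φ.le_opNorm _).trans (mul_le_mul_of_nonneg_left ?_ (norm_nonneg _))
    exact ((ρ t * T * ρ t⁻¹ - T).le_opNorm x).trans
      (mul_le_mul_of_nonneg_right (hc t) (norm_nonneg _))

end Averaging

/-! ### Uniform convexity of `L^p` -/

section UniformConvexity

variable {q : ℝ}

/-- For equal moduli the strictness comes from strict convexity of the norm on `ℂ`, otherwise from
that of `x ↦ x ^ q`. -/
lemma norm_midpoint_rpow_lt (hq : 1 < q) {a b : ℂ} (hab : a ≠ b) :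
    ‖(a + b) / 2‖ ^ q < (‖a‖ ^ q + ‖b‖ ^ q) / 2 := by
  have hq0 : 0 < q := by linarith
  have h2 : ‖(a + b) / 2‖ = ‖a + b‖ / 2 := by simp
  rw [h2]
  by_cases hn : ‖a‖ = ‖b‖
  · have h1 : ‖a + b‖ / 2 < ‖a‖ := by
      have h3 : ‖a + b‖ < ‖a‖ + ‖b‖ := by
        refine lt_of_le_of_ne (norm_add_le a b) fun h => hab ?_
        exact (sameRay_iff_norm_add.mpr h).eq_of_norm_eq hn
      linarith
    calc (‖a + b‖ / 2) ^ q < ‖a‖ ^ q := Real.rpow_lt_rpow (by positivity) h1 hq0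
      _ = _ := by rw [← hn]; ring
  · have h1 := (strictConvexOn_rpow hq).2 (Set.mem_Ici.mpr (norm_nonneg a))
      (Set.mem_Ici.mpr (norm_nonneg b)) hn (show (0 : ℝ) < 1 / 2 by norm_num)
      (show (0 : ℝ) < 1 / 2 by norm_num) (by norm_num)
    simp only [smul_eq_mul] at h1
    calc (‖a + b‖ / 2) ^ q ≤ (1 / 2 * ‖a‖ + 1 / 2 * ‖b‖) ^ q := by
          refine Real.rpow_le_rpow (by positivity) ?_ hq0.le
          linarith [norm_add_le a b]
      _ < _ := h1
      _ = _ := by ring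

lemma norm_midpoint_rpow_le (hq : 1 < q) (a b : ℂ) :
    ‖(a + b) / 2‖ ^ q ≤ (‖a‖ ^ q + ‖b‖ ^ q) / 2 := by
  rcases eq_or_ne a b with rfl | hab
  · have : (a + a) / 2 = a := by ring
    rw [this]
    linarith
  · exact (norm_midpoint_rpow_lt hq hab).le

/-- A quantitative form of the strict convexity of `z ↦ ‖z‖ ^ q`. -/
lemma exists_norm_sub_rpow_le (hq : 1 < q) {η : ℝ} (hη : 0 < η) :
    ∃ C : ℝ, 0 < C ∧ ∀ a b : ℂ, ‖a - b‖ ^ q ≤ η * (‖a‖ ^ q + ‖b‖ ^ q) +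
      C * ((‖a‖ ^ q + ‖b‖ ^ q) / 2 - ‖(a + b) / 2‖ ^ q) := by
  have hq0 : 0 < q := by linarith
  let D : ℂ × ℂ → ℝ := fun z => (‖z.1‖ ^ q + ‖z.2‖ ^ q) / 2 - ‖(z.1 + z.2) / 2‖ ^ q
  have hpow : ∀ {f : ℂ × ℂ → ℂ}, Continuous f → Continuous fun z => ‖f z‖ ^ q := fun hf =>
    hf.norm.rpow_const fun _ => Or.inr hq0.le
  have hD : Continuous D := (((hpow continuous_fst).add (hpow continuous_snd)).div_const 2).sub
    (hpow ((continuous_fst.add continuous_snd).div_const 2))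
  -- By homogeneity the unit sphere suffices. `K` contains the pairs for which the `η` term is not
  -- enough; it is compact and misses the diagonal, so `D` is bounded below there by some `d > 0`.
  let K : Set (ℂ × ℂ) := Metric.sphere 0 1 ∩
    {z | η * (‖z.1‖ ^ q + ‖z.2‖ ^ q) ≤ ‖z.1 - z.2‖ ^ q}
  have hK : IsCompact K := (isCompact_sphere 0 1).inter_right <| isClosed_le
    (((hpow continuous_fst).add (hpow continuous_snd)).const_mul η)
    (hpow (continuous_fst.sub continuous_snd))
  have hDK : ∀ z ∈ K, 0 < D z := by
    rintro ⟨a, b⟩ ⟨hz1, hz2⟩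
    refine sub_pos.mpr (norm_midpoint_rpow_lt hq ?_)
    intro (hab : a = b)
    subst hab
    simp only [Set.mem_ofPred_eq, sub_self, norm_zero, Real.zero_rpow hq0.ne'] at hz2
    have ha : ‖a‖ = 1 := by simpa [Prod.norm_def] using hz1
    rw [ha, Real.one_rpow] at hz2
    linarith
  obtain ⟨d, hd, hdK⟩ := hK.exists_forall_le' hD.continuousOn hDK
  refine ⟨2 ^ q / d, by positivity, fun a b => ?_⟩
  have hD0 : 0 ≤ (‖a‖ ^ q + ‖b‖ ^ q) / 2 - ‖(a + b) / 2‖ ^ q :=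
    sub_nonneg.mpr (norm_midpoint_rpow_le hq a b)
  by_cases hsmall : ‖a - b‖ ^ q ≤ η * (‖a‖ ^ q + ‖b‖ ^ q)
  · have : 0 ≤ 2 ^ q / d * ((‖a‖ ^ q + ‖b‖ ^ q) / 2 - ‖(a + b) / 2‖ ^ q) := by positivity
    linarith
  push Not at hsmall
  set r := ‖(a, b)‖ with hr
  have hr0 : 0 < r := by
    refine norm_pos_iff.mpr fun h => ?_
    obtain ⟨rfl, rfl⟩ := Prod.mk_eq_zero.mp h
    simp [Real.zero_rpow hq0.ne'] at hsmall
  have hrq : 0 < r ^ q := Real.rpow_pos_of_pos hr0 q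
  have hscale : ∀ z : ℂ, ‖(r : ℂ)⁻¹ * z‖ ^ q = (r ^ q)⁻¹ * ‖z‖ ^ q := by
    intro z
    rw [norm_mul, norm_inv, Complex.norm_real, Real.norm_of_nonneg hr0.le,
      Real.mul_rpow (by positivity) (norm_nonneg z), Real.inv_rpow hr0.le]
  have hmem : ((r : ℂ)⁻¹ * a, (r : ℂ)⁻¹ * b) ∈ K := by
    constructor
    · have : ((r : ℂ)⁻¹ * a, (r : ℂ)⁻¹ * b) = (r : ℂ)⁻¹ • (a, b) := rfl
      rw [mem_sphere_zero_iff_norm, this, norm_smul, norm_inv, Complex.norm_real,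
        Real.norm_of_nonneg hr0.le, ← hr, inv_mul_cancel₀ hr0.ne']
    · simp only [Set.mem_ofPred_eq]
      rw [← mul_sub, hscale, hscale, hscale, ← mul_add, mul_left_comm]
      exact mul_le_mul_of_nonneg_left hsmall.le (by positivity)
  have h1 := hdK _ hmem
  simp only [D] at h1
  rw [← mul_add, mul_div_assoc, hscale, hscale, hscale, ← mul_add, mul_div_assoc, ← mul_sub,
    ← div_eq_inv_mul, le_div_iff₀ hrq] at h1
  have h2 : ‖a - b‖ ^ q ≤ 2 ^ q * r ^ q := by
    rw [← Real.mul_rpow zero_le_two hr0.le]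
    refine Real.rpow_le_rpow (norm_nonneg _) ?_ hq0.le
    refine (norm_sub_le a b).trans ?_
    have h3 : ‖a‖ ≤ r := norm_fst_le (a, b)
    have h4 : ‖b‖ ≤ r := norm_snd_le (a, b)
    linarith
  have h3 : 2 ^ q * r ^ q ≤ 2 ^ q / d * ((‖a‖ ^ q + ‖b‖ ^ q) / 2 - ‖(a + b) / 2‖ ^ q) := by
    rw [div_mul_eq_mul_div, le_div_iff₀ hd, mul_assoc]
    refine mul_le_mul_of_nonneg_left ?_ (by positivity)
    rwa [mul_comm]
  have h4 : 0 ≤ η * (‖a‖ ^ q + ‖b‖ ^ q) := by positivity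
  linarith

variable {α : Type*} [MeasurableSpace α] {μ : Measure α} {p : ℝ≥0∞} [Fact (1 ≤ p)]

lemma Lp.norm_rpow_eq_integral (hp : p ≠ ⊤) (f : Lp ℂ p μ) :
    ‖f‖ ^ p.toReal = ∫ x, ‖f x‖ ^ p.toReal ∂μ := by
  have hp0 : p ≠ 0 := (zero_lt_one.trans_le Fact.out).ne'
  have hq : 0 < p.toReal := ENNReal.toReal_pos hp0 hp
  have hnn : 0 ≤ ∫ x, ‖f x‖ ^ p.toReal ∂μ := integral_nonneg fun x => by positivity
  rw [Lp.norm_def, (Lp.memLp f).eLpNorm_eq_integral_rpow_norm hp0 hp,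
    ENNReal.toReal_ofReal (by positivity), ← Real.rpow_mul hnn, inv_mul_cancel₀ hq.ne',
    Real.rpow_one]

/-- The pointwise inequality is integrated. With `η = ε ^ q / 4` the `η` term is `ε ^ q / 2` at unit
vectors, so the convexity defect of the midpoint must account for the other half. -/
theorem Lp.uniformConvexSpace (hp_one : 1 < p) (hp : p ≠ ⊤) : UniformConvexSpace (Lp ℂ p μ) where
  uniform_convex := by
    intro ε hε
    set q := p.toReal with hqdef
    have hp0 : p ≠ 0 := (zero_lt_one.trans hp_one).ne'
    have hq : 1 < q := by
      rw [hqdef, ← ENNReal.toReal_one]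
      exact (ENNReal.toReal_lt_toReal ENNReal.one_ne_top hp).mpr hp_one
    have hq0 : 0 < q := by linarith
    have hεq : 0 < ε ^ q := Real.rpow_pos_of_pos hε q
    obtain ⟨C, hC, hle⟩ := exists_norm_sub_rpow_le hq (η := ε ^ q / 4) (by positivity)
    have key : ∀ f g : Lp ℂ p μ, ‖f - g‖ ^ q ≤ ε ^ q / 4 * (‖f‖ ^ q + ‖g‖ ^ q) +
        C * ((‖f‖ ^ q + ‖g‖ ^ q) / 2 - ‖(2⁻¹ : ℂ) • (f + g)‖ ^ q) := by
      intro f g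
      have hInt : ∀ h : Lp ℂ p μ, Integrable (fun x => ‖h x‖ ^ q) μ := fun h =>
        (Lp.memLp h).integrable_norm_rpow hp0 hp
      simp only [hqdef, Lp.norm_rpow_eq_integral hp]
      simp only [← hqdef]
      have hfg : Integrable (fun x => ‖f x‖ ^ q + ‖g x‖ ^ q) μ := (hInt f).add (hInt g)
      have hD : Integrable (fun x => (‖f x‖ ^ q + ‖g x‖ ^ q) / 2 -
          ‖((2⁻¹ : ℂ) • (f + g) : Lp ℂ p μ) x‖ ^ q) μ := (hfg.div_const 2).sub (hInt _)
      rw [← integral_add (hInt f) (hInt g), ← integral_const_mul, ← integral_div,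
        ← integral_sub (hfg.div_const 2) (hInt _), ← integral_const_mul,
        ← integral_add (hfg.const_mul _) (hD.const_mul _)]
      refine integral_mono_ae (hInt _) ((hfg.const_mul _).add (hD.const_mul _)) ?_
      filter_upwards [Lp.coeFn_sub f g, Lp.coeFn_smul (2⁻¹ : ℂ) (f + g), Lp.coeFn_add f g]
        with x h1 h2 h3
      have h4 : ((2⁻¹ : ℂ) • (f + g) : Lp ℂ p μ) x = (f x + g x) / 2 := by
        rw [h2, Pi.smul_apply, h3, Pi.add_apply, smul_eq_mul]; ring
      simp only [h1, h4, Pi.sub_apply]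
      exact hle (f x) (g x)
    set θ := 1 - min (ε ^ q / (2 * C)) 1 with hθ
    have hθ0 : 0 ≤ θ := by simp [hθ]
    have hθ1 : θ < 1 := by
      have : 0 < min (ε ^ q / (2 * C)) 1 := by positivity
      linarith
    refine ⟨2 - 2 * θ ^ (1 / q), ?_, fun f hf g hg hfg => ?_⟩
    · have := Real.rpow_lt_one hθ0 hθ1 (by positivity : 0 < 1 / q)
      linarith
    have h1 := key f g
    rw [hf, hg, Real.one_rpow] at h1
    have h2 : ε ^ q ≤ ‖f - g‖ ^ q := Real.rpow_le_rpow hε.le hfg hq0.le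
    set s := ‖(2⁻¹ : ℂ) • (f + g)‖ with hs
    have hs2 : ‖f + g‖ = 2 * s := by rw [hs, norm_smul]; simp
    have h3 : ε ^ q / (2 * C) ≤ 1 - s ^ q := by
      rw [div_le_iff₀ (by positivity)]
      linarith
    have h4 : s ^ q ≤ θ := by linarith [min_le_left (ε ^ q / (2 * C)) 1]
    have h5 : s ≤ θ ^ (1 / q) := by
      rw [← Real.rpow_inv_rpow hθ0 hq0.ne'] at h4
      rw [one_div]
      exact (Real.rpow_le_rpow_iff (norm_nonneg _) (by positivity) hq0).mp h4
    rw [hs2]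
    linarith

end UniformConvexity

/-! ### The left regular representation and its commutant -/

section LeftTranslation

variable {G : Type*} [Group G] [TopologicalSpace G] [IsTopologicalGroup G]
  [MeasurableSpace G] [BorelSpace G] (μ : Measure G) [μ.IsMulLeftInvariant]
  (p : ℝ≥0∞) [Fact (1 ≤ p)]

lemma leftTranslation_coeFn (t : G) (f : Lp ℂ p μ) :
    leftTranslation μ p t f =ᵐ[μ] fun s => f (t⁻¹ * s) :=
  Lp.coeFn_compMeasurePreserving f (measurePreserving_mul_left μ t⁻¹)

/-- The left regular representation on `L^p(G)`. -/
def leftRegular : G →* (Lp ℂ p μ →L[ℂ] Lp ℂ p μ) where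
  toFun := leftTranslation μ p
  map_one' := by
    refine ContinuousLinearMap.ext fun f => Lp.ext ?_
    filter_upwards [leftTranslation_coeFn μ p 1 f] with x hx
    simp [hx]
  map_mul' s t := by
    refine ContinuousLinearMap.ext fun f => Lp.ext ?_
    have h1 := leftTranslation_coeFn μ p s (leftTranslation μ p t f)
    have h2 := (measurePreserving_mul_left μ s⁻¹).quasiMeasurePreserving.ae_eq_comp
      (leftTranslation_coeFn μ p t f)
    filter_upwards [leftTranslation_coeFn μ p (s * t) f, h1, h2] with x hx hx1 hx2
    rw [hx, mul_apply_eq_comp, hx1]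
    simp only [Function.comp_apply] at hx2
    rw [hx2, mul_inv_rev, mul_assoc]

lemma norm_leftRegular_le (t : G) : ‖leftRegular μ p t‖ ≤ 1 :=
  LinearIsometry.norm_toContinuousLinearMap_le _

lemma continuous_leftRegular_apply [IsLocallyFiniteMeasure μ] [μ.InnerRegularCompactLTTop]
    (hp : p ≠ ⊤) (f : Lp ℂ p μ) : Continuous fun t => leftRegular μ p t f := by
  let g : C(G, C(G, G)) :=
    (ContinuousMap.mk (fun z : G × G => z.1⁻¹ * z.2) (by fun_prop)).curry
  exact Continuous.compMeasurePreservingLp (f := fun _ : G => f) continuous_const g.continuous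
    (fun t => measurePreserving_mul_left μ t⁻¹) hp

lemma mem_convolutionOperators_iff {T : Lp ℂ p μ →L[ℂ] Lp ℂ p μ} :
    T ∈ Subalgebra.toSubmodule (convolutionOperators μ p) ↔ ∀ t, Commute T (leftRegular μ p t) :=
  ⟨fun h t => ContinuousLinearMap.ext fun f => h t f,
    fun h t f => congrArg (fun R : Lp ℂ p μ →L[ℂ] Lp ℂ p μ => R f) (h t).eq⟩

end LeftTranslation

/-! ### Reflexivity and hyperreflexivity of the convolution operators -/

section Main

variable {G : Type*} [Group G] [TopologicalSpace G] [IsTopologicalGroup G]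
  [MeasurableSpace G] [BorelSpace G] (μ : Measure G) [μ.IsMulLeftInvariant]
  (p : ℝ≥0∞) [Fact (1 ≤ p)]

/-- This is the almost-commutation estimate with `ε = 0`; no averaging is involved. -/
theorem isReflexiveOpSpace_convolutionOperators :
    IsReflexiveOpSpace (Subalgebra.toSubmodule (convolutionOperators μ p)) := by
  intro T hT
  rw [mem_convolutionOperators_iff]
  intro t
  have h := norm_conj_sub_le_of_infDist_le (leftRegular μ p) (norm_leftRegular_le μ p)
    (fun S hS => (mem_convolutionOperators_iff μ p).mp hS) le_rfl (T := T) (fun x => by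
      rw [zero_mul, (Metric.mem_closure_iff_infDist_zero ⟨0, zero_mem_opOrbit _ x⟩).mp (hT x)]) t
  rw [mul_zero] at h
  have h1 : leftRegular μ p t * T * leftRegular μ p t⁻¹ = T :=
    sub_eq_zero.mp (norm_le_zero_iff.mp h)
  have h2 : leftRegular μ p t⁻¹ * leftRegular μ p t = 1 := by
    rw [← map_mul, inv_mul_cancel, map_one]
  change T * leftRegular μ p t = leftRegular μ p t * T
  nth_rewrite 1 [← h1]
  rw [mul_assoc, h2, mul_one]

theorem mem_hyperreflexivityBounds_convolutionOperators [IsLocallyFiniteMeasure μ]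
    [μ.InnerRegularCompactLTTop] (hp_one : 1 < p) (hp_top : p < ⊤) (hG : IsAmenableGroup G) :
    288 * Real.pi * (1 + √2) ∈
      hyperreflexivityBounds (Subalgebra.toSubmodule (convolutionOperators μ p)) := by
  refine ⟨by positivity, fun T => ?_⟩
  have := Lp.uniformConvexSpace (μ := μ) hp_one hp_top.ne
  obtain ⟨S, hS, hTS⟩ := exists_commute_norm_sub_le inclusionInDoubleDual_surjective
    (norm_leftRegular_le μ p) (continuous_leftRegular_apply μ p hp_top.ne) hG T
    (norm_conj_sub_le_of_infDist_le (leftRegular μ p) (norm_leftRegular_le μ p)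
      (fun S hS => (mem_convolutionOperators_iff μ p).mp hS) (reflexiveDist_nonneg _ T)
      (infDist_opOrbit_le _ T))
  refine (Metric.infDist_le_dist_of_mem ((mem_convolutionOperators_iff μ p).mpr hS)).trans ?_
  rwa [dist_eq_norm]

end Main

end

theorem mainTheorem5 {G : Type*} [Group G] [TopologicalSpace G] [IsTopologicalGroup G]
    [LocallyCompactSpace G] [MeasurableSpace G] [BorelSpace G]
    (μ : Measure G) [μ.IsHaarMeasure] [μ.Regular]
    (p : ℝ≥0∞) [Fact (1 ≤ p)] (hp_one : 1 < p) (hp_top : p < ⊤) :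
    IsReflexiveOpSpace (Subalgebra.toSubmodule (convolutionOperators μ p)) ∧
    (IsAmenableGroup G →
      IsHyperreflexive (Subalgebra.toSubmodule (convolutionOperators μ p)) ∧
      hyperreflexivityConst (Subalgebra.toSubmodule (convolutionOperators μ p))
        ≤ 288 * Real.pi * (1 + √2)) := by
  refine ⟨isReflexiveOpSpace_convolutionOperators μ p, fun hG => ?_⟩
  have h := mem_hyperreflexivityBounds_convolutionOperators μ p hp_one hp_top hG
  exact ⟨⟨_, h⟩, csInf_le ⟨0, fun C hC => hC.1⟩ h⟩
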